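/- Let $\lambda\in\mathbb{R}\setminus\{0\}$ and let $d\ge 0$ be an integer. In each of four subcases, real polynomials $p_l=p_l(m,\alpha)$, $-1\le l\le d+1$, are defined by $p_{d+1}=0$, $p_d=1$ and, downwards for $l=d+1,d,\dots,1$, by 1. $l(l+2\alpha-1)p_l+2m(l-1)p_{l-1}=2\lambda(d-l+2)p_{l-2}$, 2. $l(l+2\alpha-1)p_l-2m(l+2\alpha-1)p_{l-1}=2\lambda(l-d-2)p_{l-2}$, 3. $l(l+1-2\alpha)p_l-2mlp_{l-1}=2\lambda(l-d-2)p_{l-2}$, 4. $l(l+1-2\alpha)p_l+2m(l-2\alpha)p_{l-1}=2\lambda(d-l+2)p_{l-2}$. In subcase 1 assume $d\ge1$. For real $m$ consider $p_{-1}=0$ as an equation in $\alpha$. There are $\delta>0$ and continuous functions $\beta_0<\beta_1<\dots<\beta_{N-1}$ on $(-\delta,\delta)$ with the following properties. For all $|m|<\delta$ if $d$ is odd, and for all $0<|m|<\delta$ if $d$ is even (for even $d$, $p_{-1}$ vanishes identically at $m=0$), the numbers $\beta_i(m)$ are simple real roots of $p_{-1}(m,\cdot)$. Their number $N$ is maximal: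 in subcases 1 and 3 there are no other complex roots; in subcases 2 and 4 all other complex roots go to infinity as $m\to0$, that is, for each $R$ there is $\varepsilon>0$ such that for all such $m$ with $|m|<\varepsilon$ there is no other root $\alpha\in\mathbb{C}$ with $|\alpha|\le R$. Moreover: **Odd $d$.** $N=(d+1)/2$, and the values $\beta_i(0)$ are the roots of $$p_{-1}(0,\alpha)=\prod_{n=0}^{(d-1)/2}\frac{(2n+1)(\alpha+n)}{\lambda c_n}\ \text{(subcases 1, 2)},\qquad p_{-1}(0,\alpha)=\prod_{n=0}^{(d-1)/2}\frac{(2n+1)(n+1-\alpha)}{\lambda c_n}\ \text{(subcases 3, 4)},$$ where $c_n=d-2n+1$ in subcases 1 and 4 and $c_n=2n-d-1$ in subcases 2 and 3. So $\beta_i(0)=i-\frac{d-1}{2}$ in subcases 1, 2 and $\beta_i(0)=i+1$ in subcases 3, 4. In subcases 1 and 2 the largest root is $\beta_{N-1}(m)=0$ for all $|m|<\delta$; in subcase 4 it is $\beta_{N-1}(m)=\frac{d+1}{2}$ for all $|m|<\delta$. **Even $d$.** Let $e_0<\dots<e_{d/2-1}$ be the roots, all simple, of $p_0(0,\alpha)$,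 which is $$\prod_{k=1}^{d/2}\frac{k(2\alpha+2k-1)}{\lambda(d-2k+2)},\quad \prod_{k=1}^{d/2}\frac{k(2\alpha+2k-1)}{\lambda(2k-d-2)},\quad \prod_{k=1}^{d/2}\frac{k(2\alpha-2k-1)}{\lambda(d-2k+2)},\quad \prod_{k=1}^{d/2}\frac{k(2k+1-2\alpha)}{\lambda(d-2k+2)}$$ in subcases 1, 2, 3, 4 respectively; thus $e_i=i+\frac12-\frac d2$ in subcases 1, 2 and $e_i=i+\frac32$ in subcases 3, 4. For all $|m|<\delta$: 1. $N=d/2$, $e_0<\beta_0<e_1<\beta_1<\dots<e_{d/2-1}<\beta_{d/2-1}$ and $\beta_{d/2-1}=0$. 2. $N=d/2+1$, $\beta_0<e_0<\beta_1<e_1<\dots<e_{d/2-1}<\beta_{d/2}$ and $\beta_{d/2}=0$. 3. $N=d/2$ and $\beta_0<e_0<\beta_1<e_1<\dots<\beta_{d/2-1}<e_{d/2-1}$. 4. $N=d/2+1$, $\beta_0<e_0<\beta_1<e_1<\dots<\beta_{d/2-1}<e_{d/2-1}$ and $\beta_{d/2}=\frac{d+1}{2}$ (which for $d\ge2$ is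 the shared root $e_{d/2-1}$). -/

import Mathlib

open Polynomial

noncomputable section

namespace DiracHeun

/-- The four subcases of the recurrence relations. -/
inductive Subcase
  | first
  | second
  | third
  | fourth

/-- The coefficient of `p_l` in the recurrence, a polynomial in the variable `X = α`. -/
def coeffA : Subcase → ℝ → ℝ[X]
  | .first, l => C l * (C l + 2 * X - 1)
  | .second, l => C l * (C l + 2 * X - 1)
  | .third, l => C l * (C l + 1 - 2 * X)
  | .fourth, l => C l * (C l + 1 - 2 * X)

/-- The coefficient of `m * p_{l-1}` in the recurrence, a polynomial in the variable `X = α`. -/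
def coeffB : Subcase → ℝ → ℝ[X]
  | .first, l => C (2 * (l - 1))
  | .second, l => -(2 * (C l + 2 * X - 1))
  | .third, l => -(C (2 * l))
  | .fourth, l => 2 * (C l - 2 * X)

/-- The coefficient of `p_{l-2}` on the right-hand side of the recurrence. -/
def coeffR : Subcase → ℕ → ℝ → ℝ → ℝ
  | .first, d, lam, l => 2 * lam * (d - l + 2)
  | .second, d, lam, l => 2 * lam * (l - d - 2)
  | .third, d, lam, l => 2 * lam * (l - d - 2)
  | .fourth, d, lam, l => 2 * lam * (d - l + 2)

/-- The polynomials generated downwards: `pDown c d lam m j` is `p_{d+1-j}`, as a polynomial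
in `α`. -/
def pDown (c : Subcase) (d : ℕ) (lam m : ℝ) : ℕ → ℝ[X]
  | 0 => 0
  | 1 => 1
  | j + 2 =>
      C (coeffR c d lam ((d : ℝ) + 1 - j))⁻¹ *
        (coeffA c ((d : ℝ) + 1 - j) * pDown c d lam m j +
          C m * coeffB c ((d : ℝ) + 1 - j) * pDown c d lam m (j + 1))

/-- The polynomial `p_l` in `α`, for `-1 ≤ l ≤ d + 1` (the values at other `l` are
never used). -/
def p (c : Subcase) (d : ℕ) (lam m : ℝ) (l : ℤ) : ℝ[X] :=
  pDown c d lam m ((d : ℤ) + 1 - l).toNat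

theorem p_top (c : Subcase) (d : ℕ) (lam m : ℝ) : p c d lam m ((d : ℤ) + 1) = 0 := by
  simp [p, pDown]

theorem p_monic (c : Subcase) (d : ℕ) (lam m : ℝ) : p c d lam m (d : ℤ) = 1 := by
  simp [p, pDown]

/-- The polynomials `p_l` satisfy the recurrence relation, in particular for `1 ≤ l ≤ d + 1`. -/
theorem p_recurrence (c : Subcase) (d : ℕ) (lam m : ℝ) (hlam : lam ≠ 0) (l : ℤ)
    (h2 : l ≤ d + 1) :
    coeffA c l * p c d lam m l + C m * coeffB c l * p c d lam m (l - 1) =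
      C (coeffR c d lam l) * p c d lam m (l - 2) := by
  obtain ⟨j, hj⟩ : ∃ j : ℕ, (d : ℤ) + 1 - l = j := ⟨((d : ℤ) + 1 - l).toNat, by omega⟩
  have hl : l = (d : ℤ) + 1 - j := by omega
  have e0 : ((d : ℤ) + 1 - l).toNat = j := by omega
  have e1 : ((d : ℤ) + 1 - (l - 1)).toNat = j + 1 := by omega
  have e2 : ((d : ℤ) + 1 - (l - 2)).toNat = j + 2 := by omega
  have hlr : (l : ℝ) = (d : ℝ) + 1 - j := by rw [hl]; push_cast; ring
  have hle : (l : ℝ) ≤ (d : ℝ) + 1 := by exact_mod_cast h2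
  have hne : coeffR c d lam l ≠ 0 := by
    cases c <;> simp only [coeffR] <;>
      refine mul_ne_zero (mul_ne_zero two_ne_zero hlam) ?_ <;> intro h <;> linarith
  simp only [p, e0, e1, e2, pDown]
  rw [← hlr, ← mul_assoc, ← C_mul, mul_inv_cancel₀ hne, C_1, one_mul]

/-- The integrability condition is the vanishing of this polynomial in `α`. -/
def pMinusOne (c : Subcase) (d : ℕ) (lam m : ℝ) : ℝ[X] := p c d lam m (-1)

/-- The explicit product for `p_{-1}` at `m = 0` when `d` is odd. -/
def oddProduct : Subcase → ℕ → ℝ → ℝ[X]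
  | .first, d, lam => ∏ n ∈ Finset.range ((d + 1) / 2),
      C ((2 * n + 1) / (lam * (d - 2 * n + 1))) * (X + C (n : ℝ))
  | .second, d, lam => ∏ n ∈ Finset.range ((d + 1) / 2),
      C ((2 * n + 1) / (lam * (2 * n - d - 1))) * (X + C (n : ℝ))
  | .third, d, lam => ∏ n ∈ Finset.range ((d + 1) / 2),
      C ((2 * n + 1) / (lam * (2 * n - d - 1))) * (C ((n : ℝ) + 1) - X)
  | .fourth, d, lam => ∏ n ∈ Finset.range ((d + 1) / 2),
      C ((2 * n + 1) / (lam * (d - 2 * n + 1))) * (C ((n : ℝ) + 1) - X)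

/-- The explicit product for `p_0` at `m = 0` when `d` is even. -/
def evenProduct : Subcase → ℕ → ℝ → ℝ[X]
  | .first, d, lam => ∏ k ∈ Finset.Icc 1 (d / 2),
      C (k / (lam * (d - 2 * k + 2))) * (2 * X + C (2 * (k : ℝ) - 1))
  | .second, d, lam => ∏ k ∈ Finset.Icc 1 (d / 2),
      C (k / (lam * (2 * k - d - 2))) * (2 * X + C (2 * (k : ℝ) - 1))
  | .third, d, lam => ∏ k ∈ Finset.Icc 1 (d / 2),
      C (k / (lam * (d - 2 * k + 2))) * (2 * X - C (2 * (k : ℝ) + 1))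
  | .fourth, d, lam => ∏ k ∈ Finset.Icc 1 (d / 2),
      C (k / (lam * (d - 2 * k + 2))) * (C (2 * (k : ℝ) + 1) - 2 * X)

/-- `e 0 < ... < e (N - 1)` are exactly the real roots of `P`, all of them simple. -/
def IsSimpleRootList (P : ℝ[X]) (N : ℕ) (e : ℕ → ℝ) : Prop :=
  (∀ i j, i < j → j < N → e i < e j) ∧
  (∀ x : ℝ, P.IsRoot x ↔ ∃ i < N, x = e i) ∧
  (∀ i < N, P.rootMultiplicity (e i) = 1)

/-- The functions `β 0 < ... < β (N - 1)` are continuous on `U`, and for `m ∈ D` their values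
at `m` are simple real roots of `P m`. -/
def SimpleRootBranches (P : ℝ → ℝ[X]) (U D : Set ℝ) (N : ℕ) (β : ℕ → ℝ → ℝ) : Prop :=
  (∀ i < N, ContinuousOn (β i) U) ∧
  (∀ m ∈ U, ∀ i j, i < j → j < N → β i m < β j m) ∧
  (∀ m ∈ D, ∀ i < N, (P m).rootMultiplicity (β i m) = 1)

/-- For `m ∈ D`, `P m` has no further roots, real or complex. -/
def NoOtherRoots (P : ℝ → ℝ[X]) (D : Set ℝ) (N : ℕ) (β : ℕ → ℝ → ℝ) : Prop :=
  ∀ m ∈ D, ∀ z : ℂ, aeval z (P m) = 0 → ∃ i < N, z = (β i m : ℂ)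

/-- All further roots of `P m`, real or complex, go to infinity when `m → 0` in `D`. -/
def OtherRootsEscape (P : ℝ → ℝ[X]) (D : Set ℝ) (N : ℕ) (β : ℕ → ℝ → ℝ) : Prop :=
  ∀ R : ℝ, ∃ ε > 0, ∀ m ∈ D, |m| < ε →
    ∀ z : ℂ, ‖z‖ ≤ R → aeval z (P m) = 0 → ∃ i < N, z = (β i m : ℂ)

/-- The symmetric neighbourhood of `0` of radius `δ`. -/
def nbhd (δ : ℝ) : Set ℝ := Set.Ioo (-δ) δ

/-- The punctured neighbourhood of `0` of radius `δ`. -/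
def puncturedNbhd (δ : ℝ) : Set ℝ := Set.Ioo (-δ) δ \ {0}

end DiracHeun

end

/-! The proof is a perturbation from m = 0. If the coefficients of a polynomial in α are polynomials
in m, each simple root at m = 0 continues to a continuous branch of simple roots, and by compactness
all other roots leave every bounded set as m → 0 (`IsPolyFamily.exists_branches`). It therefore
suffices to exhibit, at m = 0, as many distinct real roots as the degree permits.

For odd d the recursion at m = 0 runs in steps of two, so p_{-1}(0,·) is a product of linear factors
with distinct roots.

For even d = 2n, p_{-1} = m · `reduced`, and `reduced` at m = 0 comes from a triangular system. Up
to normalization, U_i = p_{d-2i} at m = 0 is a product, and V_i, the coefficient of m in p_{d+1-2i},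
satisfies V_{i+1} = g_i V_i + h_i U_i. Write the coefficient of p_l as l(l+s) with s affine in α. At
s = -2k the coefficients are nonnegative up to index n-k, which makes V positive; after that U is
zero and V picks up k negative factors. So the final value has sign (-1)^k (`sign_reduced`). These
points include the roots of p_0(0,·), and the intermediate value theorem puts roots of `reduced`
between them. Subcases 2 and 4 each need one further test point.

In subcases 1 and 3 the coefficient of p_{l-1} is free of α, so the degree is at most N for every m
and no other root exists. In subcases 2 and 4 it is linear in α; the degree is bounded by N only at
m = 0, so extra roots can only be shown to escape. The constant branches are roots for all m, frozen
by local uniqueness. -/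

namespace DiracHeun

open Filter Topology

/-! ### Counting and locating roots of a real polynomial -/

section RootCount

variable {P : ℝ[X]} {N : ℕ} {b : ℕ → ℝ}

/-- A nonzero polynomial of degree at most `N` with `N` distinct roots has no other root. -/
theorem roots_eq_map_range (hP : P ≠ 0) (hdeg : P.natDegree ≤ N)
    (hlt : ∀ i j, i < j → j < N → b i < b j) (hroot : ∀ i < N, P.IsRoot (b i)) :
    P.roots = (Multiset.range N).map b ∧ P.roots.Nodup ∧ P.Splits := by
  have hnd : ((Multiset.range N).map b).Nodup := by
    refine Multiset.Nodup.map_on ?_ (Multiset.nodup_range N)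
    intro i hi j hj hij
    rw [Multiset.mem_range] at hi hj
    rcases lt_trichotomy i j with h | h | h
    · exact absurd hij (hlt i j h hj).ne
    · exact h
    · exact absurd hij (hlt j i h hi).ne'
  have hle : (Multiset.range N).map b ≤ P.roots := by
    rw [Multiset.le_iff_subset hnd]
    intro x hx
    obtain ⟨i, hi, rfl⟩ := Multiset.mem_map.1 hx
    exact (mem_roots hP).2 (hroot i (Multiset.mem_range.1 hi))
  have heq : (Multiset.range N).map b = P.roots :=
    Multiset.eq_of_le_of_card_le hle (by simpa using (card_roots' P).trans hdeg)
  refine ⟨heq.symm, heq ▸ hnd, splits_iff_card_roots.2 (le_antisymm (card_roots' P) ?_)⟩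
  rw [← heq]
  simpa using hdeg

theorem rootMultiplicity_eq_one (hP : P ≠ 0) (hdeg : P.natDegree ≤ N)
    (hlt : ∀ i j, i < j → j < N → b i < b j) (hroot : ∀ i < N, P.IsRoot (b i)) :
    ∀ i < N, P.rootMultiplicity (b i) = 1 := by
  intro i hi
  rw [← count_roots]
  exact Multiset.count_eq_one_of_mem (roots_eq_map_range hP hdeg hlt hroot).2.1
    ((mem_roots hP).2 (hroot i hi))

theorem aeval_eq_zero_imp (hP : P ≠ 0) (hdeg : P.natDegree ≤ N)
    (hlt : ∀ i j, i < j → j < N → b i < b j) (hroot : ∀ i < N, P.IsRoot (b i))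
    {z : ℂ} (hz : aeval z P = 0) : ∃ i < N, z = (b i : ℂ) := by
  obtain ⟨h1, -, h3⟩ := roots_eq_map_range hP hdeg hlt hroot
  rw [h3.eq_prod_roots, h1] at hz
  simp only [map_mul, aeval_C, Multiset.map_map, map_multiset_prod] at hz
  rcases mul_eq_zero.1 hz with h | h
  · exact absurd h (by simpa using hP)
  · obtain ⟨i, hi, h⟩ := Multiset.mem_map.1 (Multiset.prod_eq_zero_iff.1 h)
    refine ⟨i, Multiset.mem_range.1 hi, ?_⟩
    simpa [sub_eq_zero] using h

theorem isRoot_iff_exists (hP : P ≠ 0) (hdeg : P.natDegree ≤ N)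
    (hlt : ∀ i j, i < j → j < N → b i < b j) (hroot : ∀ i < N, P.IsRoot (b i)) (x : ℝ) :
    P.IsRoot x ↔ ∃ i < N, x = b i := by
  constructor
  · intro h
    rw [← mem_roots hP, (roots_eq_map_range hP hdeg hlt hroot).1] at h
    obtain ⟨i, hi, h⟩ := Multiset.mem_map.1 h
    exact ⟨i, Multiset.mem_range.1 hi, h.symm⟩
  · rintro ⟨i, hi, rfl⟩
    exact hroot i hi

theorem isSimpleRootList_of_natDegree_le (hP : P ≠ 0) (hdeg : P.natDegree ≤ N)
    (hlt : ∀ i j, i < j → j < N → b i < b j) (hroot : ∀ i < N, P.IsRoot (b i)) :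
    IsSimpleRootList P N b :=
  ⟨hlt, isRoot_iff_exists hP hdeg hlt hroot, rootMultiplicity_eq_one hP hdeg hlt hroot⟩

/-- Alternating signs at `t 0, …, t n` produce roots between consecutive points. -/
theorem exists_roots_of_alternating (P : ℝ[X]) (t : ℕ → ℝ) (n : ℕ) (c : ℝ)
    (ht : ∀ i < n, t i < t (i + 1)) (hsign : ∀ i ≤ n, 0 < c * (-1) ^ i * P.eval (t i)) :
    ∃ b : ℕ → ℝ, ∀ i < n, t i < b i ∧ b i < t (i + 1) ∧ P.IsRoot (b i) := by
  have key : ∀ i : ℕ, ∃ x : ℝ, i < n → t i < x ∧ x < t (i + 1) ∧ P.IsRoot x := by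
    intro i
    by_cases hi : i < n
    · have h0 := hsign i hi.le
      have h1 := hsign (i + 1) hi
      have hc : c * (-1) ^ i ≠ 0 := by
        intro h
        simp [h] at h0
      -- The factor makes the left end value negative and the right end value positive, whatever the
      -- parity of `i`.
      have hcont : ContinuousOn (fun x => -(c * (-1) ^ i) * P.eval x)
          (Set.Icc (t i) (t (i + 1))) := by fun_prop
      obtain ⟨x, hx, hx0⟩ := intermediate_value_Ioo (ht i hi).le hcont
        (show (0 : ℝ) ∈ _ from ⟨by linarith, by
          rw [pow_succ] at h1
          linarith⟩)
      refine ⟨x, fun _ => ⟨hx.1, hx.2, ?_⟩⟩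
      exact (mul_eq_zero.1 hx0).resolve_left (neg_ne_zero.2 hc)
    · exact ⟨0, fun h => absurd h hi⟩
  choose b hb using key
  exact ⟨b, hb⟩

end RootCount

/-! ### Polynomial families and continuation of simple roots -/

theorem aeval_ofReal (P : ℝ[X]) (x : ℝ) : aeval (x : ℂ) P = ((P.eval x : ℝ) : ℂ) := by
  rw [aeval_def, ← Complex.coe_algebraMap, eval₂_at_apply]

/-- A family of polynomials whose coefficients depend polynomially on a parameter. -/
def IsPolyFamily (F : ℝ → ℝ[X]) : Prop :=
  ∃ G : ℝ[X][X], ∀ m, F m = G.map (evalRingHom m)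

namespace IsPolyFamily

variable {F G : ℝ → ℝ[X]}

theorem const (P : ℝ[X]) : IsPolyFamily fun _ => P :=
  ⟨P.map C, fun m => by
    rw [Polynomial.map_map]
    conv_lhs => rw [← Polynomial.map_id (p := P)]
    ext
    simp⟩

theorem eval_C (Q : ℝ[X]) : IsPolyFamily fun m => C (Q.eval m) :=
  ⟨C Q, fun m => by simp⟩

theorem add (hF : IsPolyFamily F) (hG : IsPolyFamily G) : IsPolyFamily fun m => F m + G m := by
  obtain ⟨P, hP⟩ := hF
  obtain ⟨Q, hQ⟩ := hG
  exact ⟨P + Q, fun m => by simp [hP, hQ]⟩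

theorem mul (hF : IsPolyFamily F) (hG : IsPolyFamily G) : IsPolyFamily fun m => F m * G m := by
  obtain ⟨P, hP⟩ := hF
  obtain ⟨Q, hQ⟩ := hG
  exact ⟨P * Q, fun m => by simp [hP, hQ]⟩

theorem derivative_family (hF : IsPolyFamily F) :
    IsPolyFamily fun m => derivative (F m) := by
  obtain ⟨P, hP⟩ := hF
  exact ⟨derivative P, fun m => by simp [hP, derivative_map]⟩

theorem continuous_aeval (hF : IsPolyFamily F) :
    Continuous fun q : ℝ × ℂ => aeval q.2 (F q.1) := by
  obtain ⟨P, hP⟩ := hF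
  -- The degree of `F m` may jump with `m`; summing up to the degree of the bivariate polynomial
  -- gives one range for all `m`.
  have : ∀ q : ℝ × ℂ, aeval q.2 (F q.1) =
      ∑ i ∈ Finset.range (P.natDegree + 1), (((P.coeff i).eval q.1 : ℝ) : ℂ) * q.2 ^ i := by
    intro q
    rw [hP, aeval_def, eval₂_eq_sum_range'
      (algebraMap ℝ ℂ) (lt_of_le_of_lt natDegree_map_le (Nat.lt_succ_self _))]
    simp
  simp_rw [this]
  refine continuous_finsetSum _ fun i _ => ?_
  exact (Complex.continuous_ofReal.comp ((P.coeff i).continuous.comp continuous_fst)).mul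
    (continuous_snd.pow i)

theorem continuous_aeval_left (hF : IsPolyFamily F) (z : ℂ) :
    Continuous fun m : ℝ => aeval z (F m) :=
  hF.continuous_aeval.comp (continuous_id.prodMk continuous_const)

theorem continuous_eval_left (hF : IsPolyFamily F) (x : ℝ) :
    Continuous fun m : ℝ => (F m).eval x := by
  have h := Complex.continuous_re.comp (hF.continuous_aeval_left x)
  refine h.congr fun m => ?_
  rw [Function.comp_apply, aeval_ofReal, Complex.ofReal_re]

end IsPolyFamily

theorem rootMultiplicity_eq_one_of_derivative {P : ℝ[X]} {x : ℝ} (h : P.IsRoot x)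
    (h' : (derivative P).eval x ≠ 0) : P.rootMultiplicity x = 1 := by
  have hP : P ≠ 0 := by
    rintro rfl
    simp at h'
  have h1 := (rootMultiplicity_pos hP).2 h
  have h2 : ¬ 1 < P.rootMultiplicity x := fun hlt =>
    h' ((one_lt_rootMultiplicity_iff_isRoot hP).1 hlt).2
  omega

theorem derivative_eval_ne_zero {P : ℝ[X]} {x : ℝ} (h : P.rootMultiplicity x = 1) :
    (derivative P).eval x ≠ 0 := by
  have hP : P ≠ 0 := by
    rintro rfl
    simp at h
  have hr : P.IsRoot x := (rootMultiplicity_pos hP).1 (by omega)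
  intro h'
  have := (one_lt_rootMultiplicity_iff_isRoot hP).2 ⟨hr, h'⟩
  omega

/-- A polynomial whose derivative is close to `c` on a ball is expanding there. -/
theorem norm_sub_le_of_derivative_near {P : ℝ[X]} {c a : ℂ} {r : ℝ}
    (h : ∀ z ∈ Metric.ball a r, ‖aeval z (derivative P) - c‖ ≤ ‖c‖ / 2)
    {z w : ℂ} (hz : z ∈ Metric.ball a r) (hw : w ∈ Metric.ball a r) :
    ‖aeval z P - aeval w P - c * (z - w)‖ ≤ ‖c‖ / 2 * ‖z - w‖ := by
  -- Mean value inequality for `P` minus its linear part `c * y`.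
  have hd : ∀ x ∈ Metric.ball a r, HasDerivWithinAt (fun y => aeval y P - c * y)
      (aeval x (derivative P) - c) (Metric.ball a r) x := by
    intro x _
    refine ((P.hasDerivAt_aeval x).sub ?_).hasDerivWithinAt
    simpa using (hasDerivAt_id x).const_mul c
  have := Convex.norm_image_sub_le_of_norm_hasDerivWithin_le hd h (convex_ball a r) hw hz
  have heq : aeval z P - aeval w P - c * (z - w) =
      aeval z P - c * z - (aeval w P - c * w) := by ring
  rw [heq]
  exact this

/-- The branch of roots through a simple root of `F 0`. -/
theorem IsPolyFamily.exists_branch {F : ℝ → ℝ[X]} (hF : IsPolyFamily F) {b : ℝ}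
    (hb : (F 0).IsRoot b) (hb' : (derivative (F 0)).eval b ≠ 0) :
    ∃ (β : ℝ → ℝ) (r : ℝ), 0 < r ∧ β 0 = b ∧ ∀ᶠ m in 𝓝 (0 : ℝ), ContinuousAt β m ∧
      (F m).IsRoot (β m) ∧ (F m).rootMultiplicity (β m) = 1 ∧
      ∀ z : ℂ, z ∈ Metric.ball (b : ℂ) r → aeval z (F m) = 0 → z = β m := by
  set c : ℝ := (derivative (F 0)).eval b with hc
  have hcpos : 0 < ‖(c : ℂ)‖ / 2 := by
    have : 0 < ‖(c : ℂ)‖ := by simpa using hb'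
    linarith
  have hcont := hF.derivative_family.continuous_aeval.continuousAt (x := ((0 : ℝ), (b : ℂ)))
  obtain ⟨ε, hε, hball⟩ := Metric.continuousAt_iff.1 hcont _ hcpos
  have hnear : ∀ m : ℝ, |m| < ε → ∀ z ∈ Metric.ball (b : ℂ) ε,
      ‖aeval z (derivative (F m)) - c‖ ≤ ‖(c : ℂ)‖ / 2 := by
    intro m hm z hz
    have h := hball (x := (m, z)) (by
      rw [Prod.dist_eq]
      exact max_lt (by simpa using hm) hz)
    simp only [aeval_ofReal, dist_eq_norm] at h
    exact h.le
  -- Expansion by the factor |c|/2 on a complex ball, uniformly in `m`. It yields both uniqueness of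
  -- the root and continuity of the branch.
  have hexp : ∀ m : ℝ, |m| < ε → ∀ z ∈ Metric.ball (b : ℂ) ε, ∀ w ∈ Metric.ball (b : ℂ) ε,
      ‖(c : ℂ)‖ / 2 * ‖z - w‖ ≤ ‖aeval z (F m) - aeval w (F m)‖ := by
    intro m hm z hz w hw
    have h := norm_sub_le_of_derivative_near (hnear m hm) hz hw
    have h2 := norm_sub_norm_le ((c : ℂ) * (z - w)) (aeval z (F m) - aeval w (F m))
    rw [norm_mul] at h2
    have h3 := norm_sub_rev ((c : ℂ) * (z - w)) (aeval z (F m) - aeval w (F m))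
    linarith
  have hmem : ∀ x : ℝ, |x - b| < ε → (x : ℂ) ∈ Metric.ball (b : ℂ) ε := by
    intro x hx
    rw [mem_ball_iff_norm, ← Complex.ofReal_sub, Complex.norm_real]
    exact hx
  -- At b ± ε/2 the linear part contributes c²ε/2 and the error is at most half of it, so c²ε/4
  -- remains.
  have hsign : ∀ s : ℝ, |s| = 1 → 0 < c * s * (F 0).eval (b + s * (ε / 2)) := by
    intro s hs
    have hs2 : s * s = 1 := by rw [← abs_mul_abs_self, hs, one_mul]
    have hin : |b + s * (ε / 2) - b| < ε := by
      rw [add_sub_cancel_left, abs_mul, hs, one_mul, abs_of_pos (by linarith)]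
      linarith
    have h := norm_sub_le_of_derivative_near (hnear 0 (by simpa using hε)) (hmem _ hin)
      (hmem b (by simpa using hε))
    rw [aeval_ofReal, aeval_ofReal, hb.eq_zero, ← Complex.ofReal_sub, ← Complex.ofReal_sub,
      ← Complex.ofReal_mul, ← Complex.ofReal_sub, Complex.norm_real, Complex.norm_real,
      Complex.norm_real, sub_zero, add_sub_cancel_left, Real.norm_eq_abs, Real.norm_eq_abs,
      Real.norm_eq_abs, abs_mul s, hs, one_mul, abs_of_pos (show 0 < ε / 2 by linarith)] at h
    set y := (F 0).eval (b + s * (ε / 2))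
    have hcs : |c * s| = |c| := by rw [abs_mul, hs, mul_one]
    have h1 : |c * s * (y - c * (s * (ε / 2)))| ≤ |c| * (|c| / 2 * (ε / 2)) := by
      rw [abs_mul, hcs]
      exact mul_le_mul_of_nonneg_left h (abs_nonneg c)
    have h2 := (abs_le.1 h1).1
    have h3 : |c| * |c| = c * c := abs_mul_abs_self c
    have h4 : c * s * (y - c * (s * (ε / 2))) = c * s * y - c * c * (ε / 2) := by
      linear_combination (-(c * c * (ε / 2))) * hs2
    have h5 : 0 < c * c := mul_self_pos.2 hb'
    have h6 : 0 < c * c * ε := mul_pos h5 hε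
    have h7 : |c| * (|c| / 2 * (ε / 2)) = c * c * ε / 4 := by rw [← h3]; ring
    rw [h4, h7] at h2
    linarith
  have hsigns : ∀ s : ℝ, |s| = 1 → ∀ᶠ m in 𝓝 (0 : ℝ),
      0 < c * s * (F m).eval (b + s * (ε / 2)) := fun s hs =>
    ((hF.continuous_eval_left _).const_mul (c * s)).continuousAt.eventually_const_lt (hsign s hs)
  have hsmall : ∀ᶠ m in 𝓝 (0 : ℝ), |m| < ε :=
    (continuous_abs.tendsto' 0 0 abs_zero).eventually_lt_const hε
  have hex : ∀ᶠ m in 𝓝 (0 : ℝ), ∃ x : ℝ, |x - b| < ε ∧ (F m).IsRoot x := by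
    filter_upwards [hsigns 1 (by simp), hsigns (-1) (by simp)] with m h1 h2
    have hcont : ContinuousOn (fun x => c * (F m).eval x)
        (Set.Icc (b + -1 * (ε / 2)) (b + 1 * (ε / 2))) := by fun_prop
    obtain ⟨x, hx, hx0⟩ := intermediate_value_Ioo (by linarith) hcont
      (show (0 : ℝ) ∈ _ from ⟨by linarith, by linarith⟩)
    refine ⟨x, ?_, (mul_eq_zero.1 hx0).resolve_left hb'⟩
    rw [abs_lt]
    constructor <;> linarith [hx.1, hx.2]
  classical
  have hch : ∀ m : ℝ, ∃ x : ℝ, (∃ x : ℝ, |x - b| < ε ∧ (F m).IsRoot x) →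
      |x - b| < ε ∧ (F m).IsRoot x := by
    intro m
    by_cases h : ∃ x : ℝ, |x - b| < ε ∧ (F m).IsRoot x
    · obtain ⟨x, hx⟩ := h
      exact ⟨x, fun _ => hx⟩
    · exact ⟨0, fun h' => absurd h' h⟩
  choose β hβ using hch
  have huniq : ∀ m : ℝ, |m| < ε → (∃ x : ℝ, |x - b| < ε ∧ (F m).IsRoot x) →
      ∀ z ∈ Metric.ball (b : ℂ) ε, aeval z (F m) = 0 → z = β m := by
    intro m hm hx z hz hz0
    obtain ⟨h1, h2⟩ := hβ m hx
    have h := hexp m hm z hz _ (hmem _ h1)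
    rw [hz0, aeval_ofReal, h2.eq_zero, Complex.ofReal_zero, sub_zero, norm_zero] at h
    have : ‖z - β m‖ ≤ 0 := by
      by_contra hlt
      push Not at hlt
      linarith [mul_pos hcpos hlt]
    exact sub_eq_zero.1 (norm_le_zero_iff.1 this)
  refine ⟨β, ε, hε, ?_, ?_⟩
  · have := huniq 0 (by simpa using hε) ⟨b, by simpa using hε, hb⟩ b (by simpa using hε)
      (by rw [aeval_ofReal, hb.eq_zero, Complex.ofReal_zero])
    exact_mod_cast this.symm
  · filter_upwards [hsmall.eventually_nhds, hex.eventually_nhds] with m hm1 hm2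
    have hm := hm1.self_of_nhds
    obtain ⟨h1, h2⟩ := hβ m hm2.self_of_nhds
    refine ⟨?_, h2, ?_, huniq m hm hm2.self_of_nhds⟩
    -- By expansion, |β m' - β m| is at most |F m' (β m)| / (|c|/2), which tends to 0 because β m is
    -- a root of F m.
    · have hlim : Tendsto (fun m' => ‖aeval (β m : ℂ) (F m')‖ / (‖(c : ℂ)‖ / 2)) (𝓝 m) (𝓝 0) := by
        have := ((hF.continuous_aeval_left (β m)).norm.div_const (‖(c : ℂ)‖ / 2)).tendsto m
        simpa [aeval_ofReal, h2.eq_zero] using this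
      rw [ContinuousAt, tendsto_iff_norm_sub_tendsto_zero]
      refine squeeze_zero' (Eventually.of_forall fun _ => norm_nonneg _) ?_ hlim
      filter_upwards [hm1, hm2] with m' hm1' hm2'
      obtain ⟨h1', h2'⟩ := hβ m' hm2'
      have h := hexp m' hm1' _ (hmem _ h1') _ (hmem _ h1)
      rw [aeval_ofReal _ (β m'), h2'.eq_zero, Complex.ofReal_zero, zero_sub, norm_neg,
        ← Complex.ofReal_sub, Complex.norm_real (β m' - β m)] at h
      rw [le_div_iff₀ hcpos]
      linarith
    · refine rootMultiplicity_eq_one_of_derivative h2 fun h0 => ?_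
      have h := hnear m hm _ (hmem _ h1)
      rw [aeval_ofReal, h0, Complex.ofReal_zero, zero_sub, norm_neg] at h
      linarith

/-- If `F 0` has degree at most `N` and `N` distinct real roots, these continue to branches of
simple roots of `F m`, and all other roots of `F m` escape to infinity. -/
theorem IsPolyFamily.exists_branches {F : ℝ → ℝ[X]} (hF : IsPolyFamily F) {N : ℕ}
    {b lo hi : ℕ → ℝ} (h0 : F 0 ≠ 0) (hdeg : (F 0).natDegree ≤ N)
    (hlt : ∀ i j, i < j → j < N → b i < b j) (hroot : ∀ i < N, (F 0).IsRoot (b i))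
    (hlo : ∀ i < N, lo i < b i) (hhi : ∀ i < N, b i < hi i) :
    ∃ δ > 0, ∃ β : ℕ → ℝ → ℝ, SimpleRootBranches F (nbhd δ) (nbhd δ) N β ∧
      OtherRootsEscape F (nbhd δ) N β ∧ (∀ i < N, β i 0 = b i) ∧
      (∀ m ∈ nbhd δ, ∀ i < N, lo i < β i m ∧ β i m < hi i) ∧
      (∀ i < N, (∀ m, (F m).IsRoot (b i)) → ∀ m ∈ nbhd δ, β i m = b i) ∧
      ((∀ m, (F m).natDegree ≤ N) → NoOtherRoots F (nbhd δ) N β) := by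
  have hsimple := rootMultiplicity_eq_one h0 hdeg hlt hroot
  have hbr : ∀ i, ∃ (β : ℝ → ℝ) (r : ℝ), i < N → (0 < r ∧ β 0 = b i ∧ ∀ᶠ m in 𝓝 (0 : ℝ),
      ContinuousAt β m ∧ (F m).IsRoot (β m) ∧ (F m).rootMultiplicity (β m) = 1 ∧
      ∀ z : ℂ, z ∈ Metric.ball (b i : ℂ) r → aeval z (F m) = 0 → z = β m) := by
    intro i
    by_cases hi : i < N
    · obtain ⟨β, r, h⟩ := hF.exists_branch (hroot i hi) (derivative_eval_ne_zero (hsimple i hi))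
      exact ⟨β, r, fun _ => h⟩
    · exact ⟨0, 0, fun h => absurd h hi⟩
  choose β r hβ using hbr
  have hc0 : ∀ i < N, ContinuousAt (β i) 0 := fun i hi => (hβ i hi).2.2.self_of_nhds.1
  have hall : ∀ᶠ m in 𝓝 (0 : ℝ), ∀ i ∈ Finset.range N,
      ContinuousAt (β i) m ∧ (F m).IsRoot (β i m) ∧ (F m).rootMultiplicity (β i m) = 1 ∧
      ∀ z : ℂ, z ∈ Metric.ball (b i : ℂ) (r i) → aeval z (F m) = 0 → z = β i m := by
    rw [Finset.eventually_all]
    exact fun i hi => (hβ i (Finset.mem_range.1 hi)).2.2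
  have hord : ∀ᶠ m in 𝓝 (0 : ℝ), ∀ j ∈ Finset.range N, ∀ i ∈ Finset.range j,
      β i m < β j m := by
    rw [Finset.eventually_all]
    intro j hj
    rw [Finset.eventually_all]
    intro i hi
    rw [Finset.mem_range] at hi hj
    refine (hc0 i (hi.trans hj)).eventually_lt (hc0 j hj) ?_
    rw [(hβ i (hi.trans hj)).2.1, (hβ j hj).2.1]
    exact hlt i j hi hj
  have hbd : ∀ᶠ m in 𝓝 (0 : ℝ), ∀ i ∈ Finset.range N, lo i < β i m ∧ β i m < hi i := by
    rw [Finset.eventually_all]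
    intro i hi'
    rw [Finset.mem_range] at hi'
    have hb := (hβ i hi').2.1
    exact ((hc0 i hi').eventually_const_lt (by rw [hb]; exact hlo i hi')).and
      ((hc0 i hi').eventually_lt_const (by rw [hb]; exact hhi i hi'))
  -- Needed for the final root count, which excludes the zero polynomial.
  have hne : ∀ᶠ m in 𝓝 (0 : ℝ), F m ≠ 0 := by
    obtain ⟨x, hx⟩ : ∃ x : ℝ, (F 0).eval x ≠ 0 := by
      by_contra! h
      exact h0 (Polynomial.funext (by simpa using h))
    filter_upwards [(hF.continuous_eval_left x).continuousAt.eventually_ne hx] with m hm h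
    simp [h] at hm
  obtain ⟨δ, hδ, hsub⟩ := (nhds_basis_Ioo_pos (0 : ℝ)).eventually_iff.1
    (hall.and (hord.and (hbd.and hne)))
  rw [zero_sub, zero_add] at hsub
  have hmono : ∀ m ∈ nbhd δ, ∀ i j, i < j → j < N → β i m < β j m := fun m hm i j hij hj =>
    (hsub hm).2.1 j (Finset.mem_range.2 hj) i (Finset.mem_range.2 hij)
  have hroots : ∀ m ∈ nbhd δ, ∀ i < N, (F m).IsRoot (β i m) := fun m hm i hi =>
    ((hsub hm).1 i (Finset.mem_range.2 hi)).2.1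
  refine ⟨δ, hδ, β, ⟨?_, hmono, ?_⟩, ?_, ?_, ?_, ?_, ?_⟩
  · exact fun i hi m hm =>
      ((hsub hm).1 i (Finset.mem_range.2 hi)).1.continuousWithinAt
  · exact fun m hm i hi => ((hsub hm).1 i (Finset.mem_range.2 hi)).2.2.1
  · intro R
    -- Off the small balls the disc is compact and free of roots of `F 0`, hence of roots of `F m`
    -- for small `m`. Inside a ball the only root is the branch.
    have hK : IsCompact (Metric.closedBall (0 : ℂ) R \
        ⋃ i ∈ Finset.range N, Metric.ball (b i : ℂ) (r i)) :=
      (isCompact_closedBall 0 R).diff (isOpen_biUnion fun _ _ => Metric.isOpen_ball)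
    have hev : ∀ᶠ m in 𝓝 (0 : ℝ), ∀ z ∈ Metric.closedBall (0 : ℂ) R \
        ⋃ i ∈ Finset.range N, Metric.ball (b i : ℂ) (r i), aeval z (F m) ≠ 0 := by
      refine hK.eventually_forall_of_forall_eventually fun z hz => ?_
      refine hF.continuous_aeval.continuousAt.eventually_ne fun h => hz.2 ?_
      obtain ⟨i, hi, rfl⟩ := aeval_eq_zero_imp h0 hdeg hlt hroot h
      exact Set.mem_biUnion (Finset.mem_range.2 hi) (Metric.mem_ball_self (hβ i hi).1)
    obtain ⟨ε, hε, hεsub⟩ := Metric.eventually_nhds_iff.1 hev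
    refine ⟨ε, hε, fun m hm hmε z hzR hz => ?_⟩
    have hzK := mt (hεsub (y := m) (by simpa using hmε) z) (not_not_intro hz)
    have : z ∈ ⋃ i ∈ Finset.range N, Metric.ball (b i : ℂ) (r i) := by
      by_contra h
      exact hzK ⟨by simpa using hzR, h⟩
    obtain ⟨i, hi, hzi⟩ := Set.mem_iUnion₂.1 this
    exact ⟨i, Finset.mem_range.1 hi, ((hsub hm).1 i hi).2.2.2 z hzi hz⟩
  · exact fun i hi => (hβ i hi).2.1
  · exact fun m hm i hi => (hsub hm).2.2.1 i (Finset.mem_range.2 hi)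
  · intro i hi hfix m hm
    have := ((hsub hm).1 i (Finset.mem_range.2 hi)).2.2.2 (b i)
      (Metric.mem_ball_self (hβ i hi).1)
      (by rw [aeval_ofReal, (hfix m).eq_zero, Complex.ofReal_zero])
    exact_mod_cast this.symm
  · intro hd m hm z hz
    exact aeval_eq_zero_imp (hsub hm).2.2.2 (hd m) (hmono m hm) (hroots m hm) hz

/-! ### Division of the recursion by m for even degree -/

noncomputable section Recursion

/-- The recursion of `pDown` with the factor `m` replaced by weights `w j`. -/
def weighted (c : Subcase) (d : ℕ) (lam : ℝ) (w : ℕ → ℝ) : ℕ → ℝ[X]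
  | 0 => 0
  | 1 => 1
  | j + 2 =>
      C (coeffR c d lam ((d : ℝ) + 1 - j))⁻¹ *
        (coeffA c ((d : ℝ) + 1 - j) * weighted c d lam w j +
          C (w j) * coeffB c ((d : ℝ) + 1 - j) * weighted c d lam w (j + 1))

/-- The weights that arise when the entries of even index of `pDown` are divided by `m`. -/
def evenWeight (m : ℝ) (j : ℕ) : ℝ := if Even j then 1 else m ^ 2

/-- The quotient of `p_{-1}` by `m` when `d` is even. -/
def reduced (c : Subcase) (d : ℕ) (lam m : ℝ) : ℝ[X] := weighted c d lam (evenWeight m) (d + 2)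

variable {c : Subcase} {d n : ℕ} {lam : ℝ}

theorem weighted_const (m : ℝ) (j : ℕ) : weighted c d lam (fun _ => m) j = pDown c d lam m j := by
  induction j using Nat.twoStepInduction with
  | zero => rfl
  | one => rfl
  | more j h0 h1 => rw [weighted, pDown, h0, h1]

theorem pMinusOne_eq (m : ℝ) : pMinusOne c d lam m = pDown c d lam m (d + 2) := by
  rw [pMinusOne, p]
  congr 1

theorem p_zero_eq (m : ℝ) : p c d lam m 0 = pDown c d lam m (d + 1) := by
  rw [p]
  congr 1

/-- Entries of even index are odd in m. Dividing them by m cancels the factor m in their own step,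
giving weight 1, and doubles it in the step for odd index, giving weight m². -/
theorem pDown_even_odd (m : ℝ) (i : ℕ) :
    pDown c d lam m (2 * i) = C m * weighted c d lam (evenWeight m) (2 * i) ∧
    pDown c d lam m (2 * i + 1) = weighted c d lam (evenWeight m) (2 * i + 1) := by
  induction i with
  | zero => simp [pDown, weighted]
  | succ i ih =>
    have h1 : pDown c d lam m (2 * i + 2) =
        C m * weighted c d lam (evenWeight m) (2 * i + 2) := by
      rw [pDown, weighted, ih.1, ih.2, evenWeight, if_pos (even_two_mul i), C_1]
      ring
    refine ⟨h1, ?_⟩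
    rw [show 2 * (i + 1) + 1 = (2 * i + 1) + 2 by ring, pDown, weighted, ih.2, h1, evenWeight,
      if_neg (by simp), C_pow]
    ring

theorem pMinusOne_eq_weighted (m : ℝ) :
    pMinusOne c d lam m = weighted c d lam (fun _ => m) (d + 2) := by
  rw [pMinusOne_eq, weighted_const]

theorem pMinusOne_even (hd : Even d) (m : ℝ) :
    pMinusOne c d lam m = C m * reduced c d lam m := by
  obtain ⟨i, rfl⟩ := hd
  rw [pMinusOne_eq, reduced, show i + i + 2 = 2 * (i + 1) by ring]
  exact (pDown_even_odd m (i + 1)).1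

theorem isPolyFamily_weighted (W : ℕ → ℝ[X]) (j : ℕ) :
    IsPolyFamily fun m => weighted c d lam (fun i => (W i).eval m) j := by
  induction j using Nat.twoStepInduction with
  | zero => exact IsPolyFamily.const 0
  | one => exact IsPolyFamily.const 1
  | more j h0 h1 =>
    exact (IsPolyFamily.const _).mul (((IsPolyFamily.const _).mul h0).add
      (((IsPolyFamily.eval_C _).mul (IsPolyFamily.const _)).mul h1))

theorem isPolyFamily_pMinusOne : IsPolyFamily (pMinusOne c d lam) := by
  have h := isPolyFamily_weighted (c := c) (d := d) (lam := lam) (fun _ => X) (d + 2)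
  simpa only [eval_X, weighted_const, ← pMinusOne_eq] using h

theorem isPolyFamily_reduced : IsPolyFamily (reduced c d lam) := by
  have h := isPolyFamily_weighted (c := c) (d := d) (lam := lam)
    (fun j => if Even j then 1 else X ^ 2) (d + 2)
  have hw : ∀ m, evenWeight m = fun j => (if Even j then (1 : ℝ[X]) else X ^ 2).eval m := by
    intro m
    funext j
    rw [evenWeight]
    split <;> simp
  simp only [← hw] at h
  exact h

/-! ### Degree bounds in α -/

theorem natDegree_coeffA_le (l : ℝ) : (coeffA c l).natDegree ≤ 1 := by
  cases c <;> simp only [coeffA] <;> compute_degree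

theorem natDegree_coeffB_le (l : ℝ) : (coeffB c l).natDegree ≤ 1 := by
  cases c <;> simp only [coeffB] <;> compute_degree <;> exact zero_le_one

theorem natDegree_coeffB_eq_zero (hc : c = .first ∨ c = .third) (l : ℝ) :
    (coeffB c l).natDegree = 0 := by
  rcases hc with rfl | rfl
  · exact natDegree_C _
  · rw [coeffB, natDegree_neg, natDegree_C]

theorem natDegree_step_le {A B P Q : ℝ[X]} {a b : ℝ} {k : ℕ} (hP : (A * P).natDegree ≤ k)
    (hQ : (B * Q).natDegree ≤ k) : (C a * (A * P + C b * B * Q)).natDegree ≤ k := by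
  refine (natDegree_C_mul_le _ _).trans (natDegree_add_le_of_degree_le hP ?_)
  rw [mul_assoc]
  exact (natDegree_C_mul_le _ _).trans hQ

/-- With `coeffB` constant in α, only `coeffA` raises the degree, and it acts across two indices. -/
theorem natDegree_weighted_le (hc : c = .first ∨ c = .third) (w : ℕ → ℝ) (j : ℕ) :
    (weighted c d lam w j).natDegree ≤ (j - 1) / 2 := by
  induction j using Nat.twoStepInduction with
  | zero => simp [weighted]
  | one => simp [weighted]
  | more j h0 h1 =>
    rw [weighted]
    refine natDegree_step_le ?_ ?_
    -- For `j = 0` the general estimate is one too large, but the entry multiplied by `coeffA` is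
    -- zero.
    · rcases Nat.eq_zero_or_pos j with rfl | hj
      · simp [weighted]
      · refine (natDegree_mul_le_of_le (natDegree_coeffA_le _) h0).trans ?_
        omega
    · refine (natDegree_mul_le_of_le (natDegree_coeffB_eq_zero hc _).le h1).trans ?_
      omega

/-- The weight at odd index vanishes at m = 0, so the linear `coeffB` enters only from odd-indexed
to even-indexed entries and cannot accumulate. -/
theorem natDegree_weighted_evenWeight_zero_le (i : ℕ) :
    (weighted c d lam (evenWeight 0) (2 * i)).natDegree ≤ i ∧
    (weighted c d lam (evenWeight 0) (2 * i + 1)).natDegree ≤ i := by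
  induction i with
  | zero => simp [weighted]
  | succ i ih =>
    constructor
    · rw [show 2 * (i + 1) = 2 * i + 2 by ring, weighted, add_comm i 1]
      exact natDegree_step_le (natDegree_mul_le_of_le (natDegree_coeffA_le _) ih.1)
        (natDegree_mul_le_of_le (natDegree_coeffB_le _) ih.2)
    · rw [show 2 * (i + 1) + 1 = (2 * i + 1) + 2 by ring, weighted, evenWeight,
        if_neg (by simp), zero_pow two_ne_zero, C_0, zero_mul, zero_mul, add_zero, add_comm i 1]
      exact (natDegree_C_mul_le _ _).trans
        (natDegree_mul_le_of_le (natDegree_coeffA_le _) ih.2)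

theorem natDegree_reduced_le (hc : c = .first ∨ c = .third) (m : ℝ) :
    (reduced c (2 * n) lam m).natDegree ≤ n :=
  (natDegree_weighted_le hc _ _).trans (by omega)

theorem natDegree_reduced_zero_le : (reduced c (2 * n) lam 0).natDegree ≤ n + 1 :=
  (natDegree_weighted_evenWeight_zero_le (n + 1)).1

/-! ### Signs of the limit recursion at m = 0 -/

/-- The common sign of `coeffB` and `coeffR`. -/
def sgn : Subcase → ℝ
  | .first => 1
  | .second => -1
  | .third => -1
  | .fourth => 1

/-- The affine function `s` of `α` for which the coefficient of `p_l` is `l (l + s)`. -/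
def shift : Subcase → ℝ → ℝ
  | .first, x => 2 * x - 1
  | .second, x => 2 * x - 1
  | .third, x => 1 - 2 * x
  | .fourth, x => 1 - 2 * x

/-- The coefficient of `p_{l-1}` up to sign, in terms of `s`. -/
def absB : Subcase → ℝ → ℝ → ℝ
  | .first, l, _ => 2 * (l - 1)
  | .second, l, s => 2 * (l + s)
  | .third, l, _ => 2 * l
  | .fourth, l, s => 2 * (l - 1 + s)

theorem sgn_mul_sgn : sgn c * sgn c = 1 := by cases c <;> norm_num [sgn]

theorem sgn_ne_zero : sgn c ≠ 0 := by cases c <;> norm_num [sgn]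

theorem eval_coeffA (x l : ℝ) : (coeffA c l).eval x = l * (l + shift c x) := by
  cases c <;> simp only [coeffA, shift, eval_mul, eval_add, eval_sub, eval_C, eval_X, eval_one,
    eval_ofNat] <;> ring

theorem eval_coeffB (x l : ℝ) : (coeffB c l).eval x = sgn c * absB c l (shift c x) := by
  cases c <;> simp only [coeffB, shift, sgn, absB, eval_mul, eval_add, eval_sub, eval_neg, eval_C,
    eval_X, eval_one, eval_ofNat] <;> ring

theorem coeffR_eq (j : ℝ) : coeffR c d lam ((d : ℝ) + 1 - j) = sgn c * (2 * lam) * (j + 1) := by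
  cases c <;> simp only [coeffR, sgn] <;> ring

/-- Up to index a everything is nonnegative and `h 0 > 0` starts V off. Since `f a = 0` when k > 0,
U is zero afterwards, and V is only multiplied by the negative g, k times. -/
theorem pos_then_alternating {a k : ℕ} {U V f g h : ℕ → ℝ} (hU0 : U 0 = 1) (hV0 : V 0 = 0)
    (hU : ∀ i, U (i + 1) = f i * U i) (hV : ∀ i, V (i + 1) = g i * V i + h i * U i)
    (hf : ∀ i < a, 0 < f i) (hf0 : 0 < k → f a = 0) (hg : ∀ i ≤ a, 0 < g i)
    (hg' : ∀ i, a < i → i ≤ a + k → g i < 0) (hh0 : 0 < h 0) (hh : ∀ i ≤ a, 0 ≤ h i) :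
    0 < (-1) ^ k * V (a + k + 1) := by
  have hUpos : ∀ i ≤ a, 0 < U i := by
    intro i hi
    induction i with
    | zero => simp [hU0]
    | succ i ih =>
      rw [hU]
      exact mul_pos (hf i hi) (ih (by omega))
  have hVpos : ∀ i ≤ a, 0 < V (i + 1) := by
    intro i hi
    induction i with
    | zero => rw [hV, hV0, hU0]; simpa using hh0
    | succ i ih =>
      rw [hV]
      exact add_pos_of_pos_of_nonneg (mul_pos (hg _ hi) (ih (by omega)))
        (mul_nonneg (hh _ hi) (hUpos _ hi).le)
  have hUzero : 0 < k → ∀ t, U (a + 1 + t) = 0 := by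
    intro hk t
    induction t with
    | zero => rw [add_zero, hU, hf0 hk, zero_mul]
    | succ t ih => rw [← add_assoc, hU, ih, mul_zero]
  have key : ∀ t ≤ k, 0 < (-1) ^ t * V (a + t + 1) := by
    intro t ht
    induction t with
    | zero => simpa using hVpos a le_rfl
    | succ t ih =>
      have h1 := ih (by omega)
      have h2 := hUzero (by omega) t
      rw [hV, show a + (t + 1) = a + 1 + t by ring, h2, mul_zero, add_zero,
        show a + 1 + t = a + t + 1 by ring, pow_succ]
      have h3 := mul_pos h1 (neg_pos.2 (hg' (a + t + 1) (by omega) (by omega)))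
      linarith
  exact key k le_rfl

/-- With all coefficients negative, U and V change sign together at each step and their
contributions never compete. V may start at zero because the U term is strict. -/
theorem alternating_of_neg {a k : ℕ} {U V f g h : ℕ → ℝ} (hUa : 0 < U a) (hVa : 0 ≤ V a)
    (hU : ∀ i, U (i + 1) = f i * U i) (hV : ∀ i, V (i + 1) = g i * V i + h i * U i)
    (hf : ∀ i, a ≤ i → i < a + k → f i < 0) (hg : ∀ i, a ≤ i → i ≤ a + k → g i < 0)
    (hh : ∀ i, a ≤ i → i ≤ a + k → h i < 0) :
    0 < (-1) ^ (k + 1) * V (a + k + 1) := by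
  have step : ∀ t ≤ k, 0 < (-1) ^ t * U (a + t) → 0 ≤ (-1) ^ t * V (a + t) →
      0 < (-1) ^ (t + 1) * V (a + t + 1) := by
    intro t ht h1 h2
    rw [hV, pow_succ]
    have h3 := mul_pos h1 (neg_pos.2 (hh (a + t) (by omega) (by omega)))
    have h4 := mul_nonneg h2 (neg_pos.2 (hg (a + t) (by omega) (by omega))).le
    linarith
  have key : ∀ t ≤ k, 0 < (-1) ^ t * U (a + t) ∧ 0 ≤ (-1) ^ t * V (a + t) := by
    intro t ht
    induction t with
    | zero => simpa using ⟨hUa, hVa⟩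
    | succ t ih =>
      obtain ⟨h1, h2⟩ := ih (by omega)
      refine ⟨?_, (step t (by omega) h1 h2).le⟩
      rw [← add_assoc, hU, pow_succ]
      have h3 := mul_pos h1 (neg_pos.2 (hf (a + t) (by omega) (by omega)))
      linarith
  exact step k le_rfl (key k le_rfl).1 (key k le_rfl).2

/-- The values at `x` of the limit recursion, normalized to be independent of `lam`. -/
def normU (c : Subcase) (d : ℕ) (lam x : ℝ) (i : ℕ) : ℝ :=
  (sgn c * (2 * lam)) ^ i * (weighted c d lam (evenWeight 0) (2 * i + 1)).eval x

/-- See `normU`. -/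
def normV (c : Subcase) (d : ℕ) (lam x : ℝ) (i : ℕ) : ℝ :=
  sgn c * (sgn c * (2 * lam)) ^ i * (weighted c d lam (evenWeight 0) (2 * i)).eval x

theorem normU_zero (x : ℝ) : normU c d lam x 0 = 1 := by simp [normU, weighted]

theorem normV_zero (x : ℝ) : normV c d lam x 0 = 0 := by simp [normV, weighted]

theorem normU_succ (hlam : lam ≠ 0) (x : ℝ) (i : ℕ) : normU c d lam x (i + 1) =
    ((d : ℝ) - 2 * i) * (d - 2 * i + shift c x) / (2 * i + 2) * normU c d lam x i := by
  have h1 : (2 * (i : ℝ) + 2) ≠ 0 := by positivity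
  have h2 := sgn_ne_zero (c := c)
  rw [normU, show 2 * (i + 1) + 1 = (2 * i + 1) + 2 by ring, weighted, evenWeight,
    if_neg (by simp), coeffR_eq, normU]
  simp only [eval_mul, eval_add, eval_C, eval_coeffA]
  push_cast
  have h3 : (2 * (i : ℝ) + 1 + 1) ≠ 0 := by positivity
  field_simp
  ring

theorem normV_succ (hlam : lam ≠ 0) (x : ℝ) (i : ℕ) : normV c d lam x (i + 1) =
    ((d : ℝ) + 1 - 2 * i) * (d + 1 - 2 * i + shift c x) / (2 * i + 1) * normV c d lam x i +
      absB c ((d : ℝ) + 1 - 2 * i) (shift c x) / (2 * i + 1) * normU c d lam x i := by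
  have h1 : (2 * (i : ℝ) + 1) ≠ 0 := by positivity
  have h2 := sgn_ne_zero (c := c)
  rw [normV, show 2 * (i + 1) = 2 * i + 2 by ring, weighted, evenWeight,
    if_pos (even_two_mul i), coeffR_eq, normV, normU]
  simp only [eval_mul, eval_add, eval_C, eval_coeffA, eval_coeffB]
  push_cast
  have h4 : sgn c * (2 * lam) * (sgn c * (2 * lam))⁻¹ = 1 :=
    mul_inv_cancel₀ (mul_ne_zero h2 (mul_ne_zero two_ne_zero hlam))
  have h5 := sgn_mul_sgn (c := c)
  rw [pow_succ, mul_inv _ (2 * (i : ℝ) + 1)]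
  set κ := sgn c * (2 * lam)
  set l := (d : ℝ) + 1 - 2 * i
  set s := shift c x
  set P := eval x (weighted c d lam (evenWeight 0) (2 * i))
  set Q := eval x (weighted c d lam (evenWeight 0) (2 * i + 1))
  linear_combination
    (sgn c * κ ^ i * (2 * (i : ℝ) + 1)⁻¹ * (l * (l + s) * P + sgn c * absB c l s * Q)) * h4 +
    (κ ^ i * (2 * (i : ℝ) + 1)⁻¹ * absB c l s * Q) * h5

/-- The nonzero factor that relates `reduced` at `m = 0` to `normV`. -/
def normFactor (c : Subcase) (n : ℕ) (lam : ℝ) : ℝ := sgn c * (sgn c * (2 * lam)) ^ (n + 1)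

theorem normV_eq (x : ℝ) : normV c (2 * n) lam x (n + 1) =
    normFactor c n lam * (reduced c (2 * n) lam 0).eval x := rfl

/-- With l = 2n+1-2i, the factor l + s is positive for i ≤ n-k and negative beyond, and the U
recursion hits zero exactly at i = n-k. -/
theorem sign_reduced (hlam : lam ≠ 0) {x : ℝ} {k : ℕ} (hk : k ≤ n) (hs : shift c x = -2 * k)
    (h0 : 0 < absB c (2 * n + 1) (-2 * k))
    (hB : ∀ l : ℝ, 2 * k + 1 ≤ l → 0 ≤ absB c l (-2 * k)) :
    0 < (-1) ^ k * (normFactor c n lam * (reduced c (2 * n) lam 0).eval x) := by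
  obtain ⟨a, rfl⟩ := Nat.exists_eq_add_of_le' hk
  rw [← normV_eq]
  refine pos_then_alternating (normU_zero x) (normV_zero x) (normU_succ hlam x)
    (normV_succ hlam x) ?_ ?_ ?_ ?_ ?_ ?_
  · intro i hi
    have hi' : (i : ℝ) + 1 ≤ a := by exact_mod_cast hi
    have hk0 : (0 : ℝ) ≤ k := k.cast_nonneg
    rw [hs]
    push_cast
    exact div_pos (mul_pos (by linarith) (by linarith)) (by positivity)
  · intro _
    rw [hs]
    push_cast
    ring
  · intro i hi
    have hi' : (i : ℝ) ≤ a := by exact_mod_cast hi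
    have hk0 : (0 : ℝ) ≤ k := k.cast_nonneg
    rw [hs]
    push_cast
    exact div_pos (mul_pos (by linarith) (by linarith)) (by positivity)
  · intro i hi hi2
    have hi' : (a : ℝ) + 1 ≤ i := by exact_mod_cast hi
    have hi2' : (i : ℝ) ≤ a + k := by exact_mod_cast hi2
    rw [hs]
    push_cast
    exact div_neg_of_neg_of_pos (mul_neg_of_pos_of_neg (by linarith) (by linarith))
      (by positivity)
  · rw [hs]
    push_cast at h0 ⊢
    simpa using h0
  · intro i hi
    have hi' : (i : ℝ) ≤ a := by exact_mod_cast hi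
    rw [hs]
    push_cast
    exact div_nonneg (hB _ (by linarith)) (by positivity)

/-- This point lies one unit to the left of the point k = n. All coefficients are negative here,
`absB` included, which supplies the additional sign change. -/
theorem sign_reduced_second (hlam : lam ≠ 0) {x : ℝ} (hs : shift .second x = -2 * (n + 1)) :
    0 < (-1) ^ (n + 1) *
      (normFactor .second n lam * (reduced .second (2 * n) lam 0).eval x) := by
  rw [← normV_eq]
  have h := alternating_of_neg (a := 0) (k := n) (U := normU .second (2 * n) lam x)
    (V := normV .second (2 * n) lam x) (by rw [normU_zero]; exact one_pos) (normV_zero x).ge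
    (normU_succ hlam x) (normV_succ hlam x) ?_ ?_ ?_
  · simpa using h
  · intro i _ hi
    have hi' : (i : ℝ) + 1 ≤ n := by
      rw [zero_add] at hi
      exact_mod_cast hi
    have hi0 : (0 : ℝ) ≤ i := i.cast_nonneg
    rw [hs]
    push_cast
    exact div_neg_of_neg_of_pos (mul_neg_of_pos_of_neg (by linarith) (by linarith))
      (by positivity)
  · intro i _ hi
    have hi' : (i : ℝ) ≤ n := by
      rw [zero_add] at hi
      exact_mod_cast hi
    have hi0 : (0 : ℝ) ≤ i := i.cast_nonneg
    rw [hs]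
    push_cast
    exact div_neg_of_neg_of_pos (mul_neg_of_pos_of_neg (by linarith) (by linarith))
      (by positivity)
  · intro i _ hi
    have hi0 : (0 : ℝ) ≤ i := i.cast_nonneg
    rw [hs, absB]
    push_cast
    exact div_neg_of_neg_of_pos (by linarith) (by positivity)

/-- The point s = -2n is the shared root and shows no sign. Moving s up by 1/2 keeps the
coefficients of the first step positive, and all later ones are negative. -/
theorem sign_reduced_fourth (hlam : lam ≠ 0) (hn : n ≠ 0) {x : ℝ}
    (hs : shift .fourth x = -2 * n + 1 / 2) :
    0 < (-1) ^ n * (normFactor .fourth n lam * (reduced .fourth (2 * n) lam 0).eval x) := by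
  obtain ⟨n, rfl⟩ := Nat.exists_eq_succ_of_ne_zero hn
  rw [← normV_eq]
  have hn0 : (0 : ℝ) ≤ n := n.cast_nonneg
  have h := alternating_of_neg (a := 1) (k := n) (U := normU .fourth (2 * (n + 1)) lam x)
    (V := normV .fourth (2 * (n + 1)) lam x) ?_ ?_
    (normU_succ hlam x) (normV_succ hlam x) ?_ ?_ ?_
  · rwa [add_comm 1 n] at h
  · rw [normU_succ hlam, normU_zero, hs]
    push_cast
    refine mul_pos (div_pos (mul_pos ?_ ?_) ?_) one_pos <;> linarith
  · rw [normV_succ hlam, normU_zero, normV_zero, hs, absB]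
    push_cast
    rw [mul_zero, zero_add]
    refine mul_nonneg (div_nonneg ?_ ?_) zero_le_one <;> linarith
  · intro i hi1 hi
    have hi1' : (1 : ℝ) ≤ i := by exact_mod_cast hi1
    have hi' : (i : ℝ) + 1 ≤ 1 + n := by exact_mod_cast hi
    rw [hs]
    push_cast
    exact div_neg_of_neg_of_pos (mul_neg_of_pos_of_neg (by linarith) (by linarith))
      (by positivity)
  · intro i hi1 hi
    have hi1' : (1 : ℝ) ≤ i := by exact_mod_cast hi1
    have hi' : (i : ℝ) ≤ 1 + n := by exact_mod_cast hi
    rw [hs]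
    push_cast
    exact div_neg_of_neg_of_pos (mul_neg_of_pos_of_neg (by linarith) (by linarith))
      (by positivity)
  · intro i hi1 hi
    have hi1' : (1 : ℝ) ≤ i := by exact_mod_cast hi1
    rw [hs, absB]
    push_cast
    exact div_neg_of_neg_of_pos (by linarith) (by positivity)

/-! ### Product formulas at m = 0 -/

/-- At `m = 0` the recursion is a product. -/
theorem pDown_zero_odd (i : ℕ) : pDown c d lam 0 (2 * i + 1) =
    ∏ t ∈ Finset.range i, (C (coeffR c d lam ((d : ℝ) - 2 * t))⁻¹ * coeffA c ((d : ℝ) - 2 * t)) := by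
  induction i with
  | zero => simp [pDown]
  | succ i ih =>
    rw [Finset.prod_range_succ, ← ih, show 2 * (i + 1) + 1 = (2 * i + 1) + 2 by ring, pDown,
      C_0, zero_mul, zero_mul, add_zero]
    push_cast
    rw [show (d : ℝ) + 1 - (2 * i + 1) = d - 2 * i by ring]
    ring

theorem pMinusOne_zero_odd (n : ℕ) : pMinusOne c (2 * n + 1) lam 0 =
    ∏ t ∈ Finset.range (n + 1),
      (C (coeffR c (2 * n + 1 : ℕ) lam (2 * t + 1))⁻¹ * coeffA c (2 * t + 1)) := by
  rw [pMinusOne_eq, show 2 * n + 1 + 2 = 2 * (n + 1) + 1 by ring, pDown_zero_odd,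
    -- The recursion lists the factors by decreasing l, the stated product by increasing l.
    ← Finset.prod_range_reflect]
  refine Finset.prod_congr rfl fun t ht => ?_
  have ht' : t ≤ n := by
    have := Finset.mem_range.1 ht
    omega
  have : ((2 * n + 1 : ℕ) : ℝ) - 2 * ((n + 1 - 1 - t : ℕ) : ℝ) = 2 * t + 1 := by
    rw [Nat.add_sub_cancel, Nat.cast_sub ht']
    push_cast
    ring
  rw [this]

theorem p_zero_even (n : ℕ) : p c (2 * n) lam 0 0 =
    ∏ k ∈ Finset.Icc 1 n, (C (coeffR c (2 * n : ℕ) lam (2 * k))⁻¹ * coeffA c (2 * k)) := by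
  rw [p_zero_eq, pDown_zero_odd, ← Finset.prod_range_reflect]
  have hI : Finset.Icc 1 n = Finset.Ico 1 (n + 1) := by
    ext
    simp
  rw [hI, Finset.prod_Ico_eq_prod_range]
  refine Finset.prod_congr rfl fun t ht => ?_
  have ht' : t + 1 ≤ n := Finset.mem_range.1 ht
  have : ((2 * n : ℕ) : ℝ) - 2 * ((n - 1 - t : ℕ) : ℝ) = 2 * ((1 + t : ℕ) : ℝ) := by
    rw [Nat.sub_sub, add_comm 1 t, Nat.cast_sub ht']
    push_cast
    ring
  rw [this]

theorem C_inv_mul_eq {e r q a : ℝ} {A B : ℝ[X]} (he : e ≠ 0) (hr : r = e * q)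
    (hA : A = C (e * a) * B) : C r⁻¹ * A = C (a / q) * B := by
  rw [hr, hA, ← mul_assoc, ← C_mul, mul_inv]
  congr 2
  rw [mul_mul_mul_comm, inv_mul_cancel₀ he, one_mul, div_eq_inv_mul]

theorem pMinusOne_zero_eq_oddProduct (n : ℕ) :
    pMinusOne c (2 * n + 1) lam 0 = oddProduct c (2 * n + 1) lam := by
  rw [pMinusOne_zero_odd]
  cases c <;> rw [oddProduct, show (2 * n + 1 + 1) / 2 = n + 1 by omega] <;>
  · refine Finset.prod_congr rfl fun t ht =>
      C_inv_mul_eq two_ne_zero (by rw [coeffR]; ring) (Polynomial.funext fun y => ?_)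
    simp only [coeffA, eval_mul, eval_add, eval_sub, eval_C, eval_X, eval_one, eval_ofNat]
    ring

theorem p_zero_eq_evenProduct (n : ℕ) :
    p c (2 * n) lam 0 0 = evenProduct c (2 * n) lam := by
  rw [p_zero_even]
  cases c <;> rw [evenProduct, show 2 * n / 2 = n by omega]
  -- Here the stated product has both the scalar and the linear factor negated, so the common factor
  -- to cancel is -2.
  case third =>
    refine Finset.prod_congr rfl fun t ht =>
      C_inv_mul_eq (neg_ne_zero.2 two_ne_zero) (by rw [coeffR]; ring)
        (Polynomial.funext fun y => ?_)
    simp only [coeffA, eval_mul, eval_add, eval_sub, eval_C, eval_X, eval_one, eval_ofNat]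
    ring
  all_goals
    refine Finset.prod_congr rfl fun t ht =>
      C_inv_mul_eq two_ne_zero (by rw [coeffR]; ring) (Polynomial.funext fun y => ?_)
    simp only [coeffA, eval_mul, eval_add, eval_sub, eval_C, eval_X, eval_one, eval_ofNat]
    try ring

theorem coeffR_inv_ne_zero (hlam : lam ≠ 0) {l : ℝ} (hl : l ≤ d) :
    (coeffR c d lam l)⁻¹ ≠ 0 := by
  have h := coeffR_eq (c := c) (d := d) (lam := lam) ((d : ℝ) + 1 - l)
  rw [sub_sub_cancel] at h
  rw [h]
  exact inv_ne_zero (mul_ne_zero (mul_ne_zero sgn_ne_zero (mul_ne_zero two_ne_zero hlam))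
    (by linarith))

theorem coeffA_ne_zero {l : ℝ} (hl : l ≠ 0) : coeffA c l ≠ 0 := by
  -- At s = 1 - l the value l(l+s) equals l.
  obtain ⟨x, hx⟩ : ∃ x, shift c x = 1 - l := by
    cases c
    · exact ⟨(2 - l) / 2, by rw [shift]; ring⟩
    · exact ⟨(2 - l) / 2, by rw [shift]; ring⟩
    · exact ⟨l / 2, by rw [shift]; ring⟩
    · exact ⟨l / 2, by rw [shift]; ring⟩
  intro h
  have h1 := eval_coeffA (c := c) x l
  rw [h, hx, eval_zero] at h1
  exact hl (by linarith)

theorem oddProduct_ne_zero (hlam : lam ≠ 0) (n : ℕ) : oddProduct c (2 * n + 1) lam ≠ 0 := by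
  rw [← pMinusOne_zero_eq_oddProduct, pMinusOne_zero_odd, Finset.prod_ne_zero_iff]
  intro t ht
  have ht' : (t : ℝ) ≤ n := by exact_mod_cast Nat.lt_succ_iff.1 (Finset.mem_range.1 ht)
  refine mul_ne_zero (C_ne_zero.2 (coeffR_inv_ne_zero hlam ?_))
    (coeffA_ne_zero (by positivity))
  push_cast
  linarith

theorem evenProduct_ne_zero (hlam : lam ≠ 0) (n : ℕ) : evenProduct c (2 * n) lam ≠ 0 := by
  rw [← p_zero_eq_evenProduct, p_zero_even, Finset.prod_ne_zero_iff]
  intro t ht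
  have ht1 : (1 : ℝ) ≤ t := by exact_mod_cast (Finset.mem_Icc.1 ht).1
  have ht' : (t : ℝ) ≤ n := by exact_mod_cast (Finset.mem_Icc.1 ht).2
  refine mul_ne_zero (C_ne_zero.2 (coeffR_inv_ne_zero hlam ?_))
    (coeffA_ne_zero (by positivity))
  push_cast
  linarith

theorem natDegree_C_mul_coeffA_le (a l : ℝ) : (C a * coeffA c l).natDegree ≤ 1 :=
  (natDegree_C_mul_le _ _).trans (natDegree_coeffA_le l)

theorem natDegree_oddProduct_le (n : ℕ) : (oddProduct c (2 * n + 1) lam).natDegree ≤ n + 1 := by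
  rw [← pMinusOne_zero_eq_oddProduct, pMinusOne_zero_odd]
  refine (natDegree_prod_le _ _).trans ((Finset.sum_le_card_nsmul _ _ 1 fun t _ =>
    natDegree_C_mul_coeffA_le _ _).trans ?_)
  simp

theorem natDegree_evenProduct_le (n : ℕ) : (evenProduct c (2 * n) lam).natDegree ≤ n := by
  rw [← p_zero_eq_evenProduct, p_zero_even]
  refine (natDegree_prod_le _ _).trans ((Finset.sum_le_card_nsmul _ _ 1 fun t _ =>
    natDegree_C_mul_coeffA_le _ _).trans ?_)
  simp

theorem isRoot_oddProduct {x : ℝ} {t : ℕ} (ht : t ≤ n) (hx : shift c x = -(2 * t + 1)) :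
    (oddProduct c (2 * n + 1) lam).IsRoot x := by
  rw [← pMinusOne_zero_eq_oddProduct, pMinusOne_zero_odd, IsRoot.def, eval_prod]
  refine Finset.prod_eq_zero (Finset.mem_range.2 (Nat.lt_succ_of_le ht)) ?_
  rw [eval_mul, eval_coeffA, hx]
  ring

theorem isRoot_evenProduct {x : ℝ} {k : ℕ} (hk : 1 ≤ k) (hkn : k ≤ n)
    (hx : shift c x = -2 * k) : (evenProduct c (2 * n) lam).IsRoot x := by
  rw [← p_zero_eq_evenProduct, p_zero_even, IsRoot.def, eval_prod]
  refine Finset.prod_eq_zero (Finset.mem_Icc.2 ⟨hk, hkn⟩) ?_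
  rw [eval_mul, eval_coeffA, hx]
  ring

/-! ### Roots that do not depend on m -/

/-- In the first two subcases `0` is a root of the last entry of the recursion. -/
theorem isRoot_weighted_zero (hc : c = .first ∨ c = .second) (w : ℕ → ℝ) :
    (weighted c d lam w (d + 2)).IsRoot 0 := by
  rw [IsRoot.def, weighted]
  -- The last step has l = 1, and at α = 0 both of its coefficients vanish.
  simp only [eval_mul, eval_add, eval_coeffA, eval_coeffB, add_sub_cancel_left]
  rcases hc with rfl | rfl <;> simp [shift, absB]

/-- In the fourth subcase all entries after the first two share a root. -/
theorem isRoot_weighted_fourth (w : ℕ → ℝ) (j : ℕ) :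
    (weighted .fourth d lam w (j + 2)).IsRoot (((d : ℝ) + 1) / 2) := by
  have hs : shift .fourth (((d : ℝ) + 1) / 2) = -d := by
    rw [shift]
    ring
  -- At s = -d, `absB` vanishes for l = d+1, which kills entry 2; `coeffA` vanishes for l = d, which
  -- then kills entry 3. Two consecutive zeros propagate.
  have h2 : (weighted .fourth d lam w 2).eval (((d : ℝ) + 1) / 2) = 0 := by
    rw [weighted]
    simp only [eval_mul, eval_add, eval_coeffB, hs, absB, weighted, eval_zero]
    push_cast
    ring
  induction j using Nat.twoStepInduction with
  | zero => exact h2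
  | one =>
    rw [IsRoot.def, weighted]
    simp only [eval_mul, eval_add, eval_coeffA, hs, h2]
    push_cast
    ring
  | more j h0 h1 =>
    rw [IsRoot.def, weighted]
    simp only [eval_mul, eval_add, h0.eq_zero, h1.eq_zero]
    ring

end Recursion

/-! ### Branches for odd degree, and transfer from the reduced polynomial -/

section Cases

variable {c : Subcase} {n N : ℕ} {lam δ : ℝ} {β : ℕ → ℝ → ℝ}

theorem aeval_reduced_eq_zero {m : ℝ} (hm : m ∈ puncturedNbhd δ) {z : ℂ}
    (hz : aeval z (pMinusOne c (2 * n) lam m) = 0) : aeval z (reduced c (2 * n) lam m) = 0 := by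
  rw [pMinusOne_even (even_two_mul n), map_mul, aeval_C] at hz
  exact (mul_eq_zero.1 hz).resolve_left (by simpa using hm.2)

theorem simpleRootBranches_even
    (h : SimpleRootBranches (reduced c (2 * n) lam) (nbhd δ) (nbhd δ) N β) :
    SimpleRootBranches (pMinusOne c (2 * n) lam) (nbhd δ) (puncturedNbhd δ) N β := by
  refine ⟨h.1, h.2.1, fun m hm i hi => ?_⟩
  rw [pMinusOne_even (even_two_mul n), ← count_roots,
    roots_C_mul _ (show m ≠ 0 from hm.2), count_roots]
  exact h.2.2 m hm.1 i hi

theorem otherRootsEscape_even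
    (h : OtherRootsEscape (reduced c (2 * n) lam) (nbhd δ) N β) :
    OtherRootsEscape (pMinusOne c (2 * n) lam) (puncturedNbhd δ) N β := by
  intro R
  obtain ⟨ε, hε, h⟩ := h R
  exact ⟨ε, hε, fun m hm hmε z hzR hz =>
    h m hm.1 hmε z hzR (aeval_reduced_eq_zero hm hz)⟩

theorem noOtherRoots_even
    (h : NoOtherRoots (reduced c (2 * n) lam) (nbhd δ) N β) :
    NoOtherRoots (pMinusOne c (2 * n) lam) (puncturedNbhd δ) N β :=
  fun m hm z hz => h m hm.1 z (aeval_reduced_eq_zero hm hz)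

theorem lt_of_between {N : ℕ} {t b : ℕ → ℝ} (ht : ∀ i j, i ≤ j → j ≤ N → t i ≤ t j)
    (hb : ∀ i < N, t i < b i ∧ b i < t (i + 1)) : ∀ i j, i < j → j < N → b i < b j :=
  fun i j hij hj => ((hb i (hij.trans hj)).2.trans_le (ht (i + 1) j hij hj.le)).trans (hb j hj).1

theorem ne_zero_of_sign {P : ℝ[X]} {a x : ℝ} (h : 0 < a * P.eval x) : P ≠ 0 := by
  rintro rfl
  simp at h

/-- The branches for odd degree, starting at the roots of the explicit product. -/
theorem exists_branches_odd (hlam : lam ≠ 0) {b : ℕ → ℝ} (hmono : StrictMono b)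
    (hb : ∀ i ≤ n, ∃ t ≤ n, shift c (b i) = -(2 * (t : ℝ) + 1)) :
    ∃ δ > 0, ∃ β : ℕ → ℝ → ℝ,
      SimpleRootBranches (pMinusOne c (2 * n + 1) lam) (nbhd δ) (nbhd δ) (n + 1) β ∧
      OtherRootsEscape (pMinusOne c (2 * n + 1) lam) (nbhd δ) (n + 1) β ∧
      (∀ i < n + 1, β i 0 = b i) ∧
      (∀ i < n + 1, (∀ m, (pMinusOne c (2 * n + 1) lam m).IsRoot (b i)) →
        ∀ m ∈ nbhd δ, β i m = b i) ∧
      (c = .first ∨ c = .third →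
        NoOtherRoots (pMinusOne c (2 * n + 1) lam) (nbhd δ) (n + 1) β) := by
  have h0 := pMinusOne_zero_eq_oddProduct (c := c) (lam := lam) n
  obtain ⟨δ, hδ, β, h1, h2, h3, -, h5, h6⟩ :=
    (isPolyFamily_pMinusOne (c := c) (d := 2 * n + 1) (lam := lam)).exists_branches (N := n + 1)
      -- For odd degree no interlacing is claimed, so any bounds around `b i` serve.
      (b := b) (lo := fun i => b i - 1) (hi := fun i => b i + 1)
      (by rw [h0]; exact oddProduct_ne_zero hlam n)
      (by rw [h0]; exact natDegree_oddProduct_le n) (fun i j hij _ => hmono hij)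
      (fun i hi => by
        obtain ⟨t, ht, hs⟩ := hb i (Nat.lt_succ_iff.1 hi)
        rw [h0]
        exact isRoot_oddProduct ht hs)
      (fun i _ => sub_one_lt _) (fun i _ => lt_add_one _)
  refine ⟨δ, hδ, β, h1, h2, h3, h5, fun hc => h6 fun m => ?_⟩
  rw [pMinusOne_eq_weighted]
  exact (natDegree_weighted_le hc _ _).trans (by omega)

theorem shift_left (hc : c = .first ∨ c = .second) (x : ℝ) : shift c x = 2 * x - 1 := by
  rcases hc with rfl | rfl <;> rfl

theorem shift_right (hc : c = .third ∨ c = .fourth) (x : ℝ) : shift c x = 1 - 2 * x := by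
  rcases hc with rfl | rfl <;> rfl

theorem exists_branches_odd_left (hc : c = .first ∨ c = .second) (hlam : lam ≠ 0) :
    ∃ δ > 0, ∃ β : ℕ → ℝ → ℝ,
      SimpleRootBranches (pMinusOne c (2 * n + 1) lam) (nbhd δ) (nbhd δ) (n + 1) β ∧
      OtherRootsEscape (pMinusOne c (2 * n + 1) lam) (nbhd δ) (n + 1) β ∧
      (∀ i < n + 1, β i 0 = (i : ℝ) - (((2 * n + 1 : ℕ) : ℝ) - 1) / 2) ∧
      (∀ m ∈ nbhd δ, β n m = 0) ∧
      (c = .first ∨ c = .third →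
        NoOtherRoots (pMinusOne c (2 * n + 1) lam) (nbhd δ) (n + 1) β) := by
  obtain ⟨δ, hδ, β, h1, h2, h3, h4, h5⟩ :=
    exists_branches_odd (c := c) (n := n) hlam (b := fun i => (i : ℝ) - n)
      (fun i j hij => by simpa using hij) (fun i hi => ⟨n - i, by omega, by
        rw [shift_left hc, Nat.cast_sub hi]
        ring⟩)
  refine ⟨δ, hδ, β, h1, h2, fun i hi => ?_, fun m hm => ?_, h5⟩
  · rw [h3 i hi]
    push_cast
    ring
  · have := h4 n n.lt_succ_self (fun m => by
      rw [sub_self, pMinusOne_eq_weighted]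
      exact isRoot_weighted_zero hc _) m hm
    rwa [sub_self] at this

theorem exists_branches_odd_right (hc : c = .third ∨ c = .fourth) (hlam : lam ≠ 0) :
    ∃ δ > 0, ∃ β : ℕ → ℝ → ℝ,
      SimpleRootBranches (pMinusOne c (2 * n + 1) lam) (nbhd δ) (nbhd δ) (n + 1) β ∧
      OtherRootsEscape (pMinusOne c (2 * n + 1) lam) (nbhd δ) (n + 1) β ∧
      (∀ i < n + 1, β i 0 = (i : ℝ) + 1) ∧
      (c = .fourth → ∀ m ∈ nbhd δ, β n m = (((2 * n + 1 : ℕ) : ℝ) + 1) / 2) ∧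
      (c = .first ∨ c = .third →
        NoOtherRoots (pMinusOne c (2 * n + 1) lam) (nbhd δ) (n + 1) β) := by
  obtain ⟨δ, hδ, β, h1, h2, h3, h4, h5⟩ :=
    exists_branches_odd (c := c) (n := n) hlam (b := fun i => (i : ℝ) + 1)
      (fun i j hij => by simpa using hij) (fun i hi => ⟨i, hi, by
        rw [shift_right hc]
        ring⟩)
  refine ⟨δ, hδ, β, h1, h2, h3, ?_, h5⟩
  rintro rfl m hm
  have hn : (((2 * n + 1 : ℕ) : ℝ) + 1) / 2 = n + 1 := by
    push_cast
    ring
  rw [hn]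
  refine h4 n n.lt_succ_self (fun m => ?_) m hm
  rw [pMinusOne_eq_weighted, ← hn]
  exact isRoot_weighted_fourth _ _

theorem isSimpleRootList_evenProduct_left (hc : c = .first ∨ c = .second) (hlam : lam ≠ 0) :
    IsSimpleRootList (evenProduct c (2 * n) lam) n
      (fun i => (i : ℝ) + 1 / 2 - ((2 * n : ℕ) : ℝ) / 2) := by
  refine isSimpleRootList_of_natDegree_le (evenProduct_ne_zero hlam n)
    (natDegree_evenProduct_le n) (fun i j hij _ => by simpa using hij) fun i hi => ?_
  refine isRoot_evenProduct (k := n - i) (by omega) (by omega) ?_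
  rw [shift_left hc, Nat.cast_sub hi.le]
  push_cast
  ring

theorem isSimpleRootList_evenProduct_right (hc : c = .third ∨ c = .fourth) (hlam : lam ≠ 0) :
    IsSimpleRootList (evenProduct c (2 * n) lam) n (fun i => (i : ℝ) + 3 / 2) := by
  refine isSimpleRootList_of_natDegree_le (evenProduct_ne_zero hlam n)
    (natDegree_evenProduct_le n) (fun i j hij _ => by simpa using hij) fun i hi => ?_
  refine isRoot_evenProduct (k := i + 1) (by omega) (by omega) ?_
  rw [shift_right hc]
  push_cast
  ring

theorem neg_one_pow_sub {i : ℕ} (hi : i ≤ n) : (-1 : ℝ) ^ (n - i) = (-1) ^ n * (-1) ^ i := by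
  obtain ⟨k, rfl⟩ := Nat.exists_eq_add_of_le hi
  rw [Nat.add_sub_cancel_left, pow_add, mul_right_comm, ← mul_pow]
  simp

/-! ### Branches for even degree -/

/-- The test points are e_0, …, e_{n-1} and 1/2, corresponding to k = n, …, 0; their n gaps exhaust
the degree. -/
theorem exists_branches_first_even (hlam : lam ≠ 0) (hn : n ≠ 0) :
    ∃ δ > 0, ∃ β : ℕ → ℝ → ℝ,
      SimpleRootBranches (pMinusOne .first (2 * n) lam) (nbhd δ) (puncturedNbhd δ) n β ∧
      NoOtherRoots (pMinusOne .first (2 * n) lam) (puncturedNbhd δ) n β ∧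
      (∀ m ∈ nbhd δ, ∀ i < n, (i : ℝ) + 1 / 2 - n < β i m ∧ β i m < (i : ℝ) + 3 / 2 - n) ∧
      (∀ m ∈ nbhd δ, β (n - 1) m = 0) := by
  have hn1 : (1 : ℝ) ≤ n := by exact_mod_cast Nat.one_le_iff_ne_zero.2 hn
  have hsign : ∀ i ≤ n, 0 < (-1) ^ n * normFactor .first n lam * (-1) ^ i *
      (reduced .first (2 * n) lam 0).eval ((i : ℝ) + 1 / 2 - n) := by
    intro i hi
    have h := sign_reduced (c := .first) hlam (x := (i : ℝ) + 1 / 2 - n) (Nat.sub_le n i)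
      (by rw [shift, Nat.cast_sub hi]; ring) (by rw [absB]; linarith)
      (fun l hl => by
        have : (0 : ℝ) ≤ (n - i : ℕ) := Nat.cast_nonneg _
        rw [absB]
        linarith)
    rw [neg_one_pow_sub hi] at h
    linarith
  obtain ⟨b, hb⟩ := exists_roots_of_alternating (reduced .first (2 * n) lam 0)
    (fun i => (i : ℝ) + 1 / 2 - n) n _ (fun i _ => by push_cast; linarith) hsign
  have h0 := ne_zero_of_sign (hsign 0 n.zero_le)
  have hlt := lt_of_between (N := n) (t := fun i : ℕ => (i : ℝ) + 1 / 2 - n) (b := b)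
    (fun i j hij _ => by simpa using hij) (fun i hi => ⟨(hb i hi).1, (hb i hi).2.1⟩)
  have hdeg := natDegree_reduced_le (n := n) (lam := lam) (c := .first) (.inl rfl)
  have hfix : ∀ m, (reduced .first (2 * n) lam m).IsRoot 0 := fun m =>
    isRoot_weighted_zero (.inl rfl) _
  -- The root 0 is some `b j`, and `b j < j + 3/2 - n` forces j = n - 1.
  have hlast : b (n - 1) = 0 := by
    obtain ⟨j, hj, h⟩ := (isRoot_iff_exists h0 (hdeg 0) hlt (fun i hi => (hb i hi).2.2) 0).1
      (hfix 0)
    have h2 := (hb j hj).2.1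
    rw [← h] at h2
    push_cast at h2
    have h3 : (n : ℝ) < (j + 2 : ℕ) := by
      push_cast
      linarith
    have h4 : n < j + 2 := by exact_mod_cast h3
    rw [h]
    congr 1
    omega
  obtain ⟨δ, hδ, β, h1, -, -, h4, h5, h6⟩ := isPolyFamily_reduced.exists_branches h0 (hdeg 0) hlt
    (fun i hi => (hb i hi).2.2) (fun i hi => (hb i hi).1) (fun i hi => (hb i hi).2.1)
  refine ⟨δ, hδ, β, simpleRootBranches_even h1, noOtherRoots_even (h6 hdeg), ?_, ?_⟩
  · intro m hm i hi
    have := h4 m hm i hi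
    push_cast at this
    exact ⟨this.1, by linarith⟩
  · intro m hm
    rw [← hlast]
    exact h5 (n - 1) (by omega) (fun m => hlast ▸ hfix m) m hm

/-- To the points with k = n, …, 0 the one with s = -2(n+1) is added on the left, so there are n + 1
gaps, matching the degree at m = 0. -/
theorem exists_branches_second_even (hlam : lam ≠ 0) :
    ∃ δ > 0, ∃ β : ℕ → ℝ → ℝ,
      SimpleRootBranches (pMinusOne .second (2 * n) lam) (nbhd δ) (puncturedNbhd δ) (n + 1) β ∧
      OtherRootsEscape (pMinusOne .second (2 * n) lam) (puncturedNbhd δ) (n + 1) β ∧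
      (∀ m ∈ nbhd δ, ∀ i < n + 1,
        (i : ℝ) - 1 / 2 - n < β i m ∧ β i m < (i : ℝ) + 1 / 2 - n) ∧
      (∀ m ∈ nbhd δ, β n m = 0) := by
  have hsign : ∀ i ≤ n + 1, 0 < (-1) ^ (n + 1) * normFactor .second n lam * (-1) ^ i *
      (reduced .second (2 * n) lam 0).eval ((i : ℝ) - 1 / 2 - n) := by
    intro i hi
    rcases Nat.eq_zero_or_pos i with rfl | hpos
    · have h := sign_reduced_second (n := n) hlam (x := ((0 : ℕ) : ℝ) - 1 / 2 - n)
        (by rw [shift]; push_cast; ring)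
      linarith
    · have h := sign_reduced (c := .second) (n := n) hlam (x := (i : ℝ) - 1 / 2 - n)
        (k := n + 1 - i) (by omega)
        (by rw [shift, Nat.cast_sub hi]; push_cast; ring)
        (by
          have hi1 : (1 : ℝ) ≤ i := by exact_mod_cast hpos
          rw [absB, Nat.cast_sub hi]
          push_cast
          linarith)
        (fun l hl => by
          rw [absB]
          linarith)
      rw [neg_one_pow_sub hi] at h
      linarith
  obtain ⟨b, hb⟩ := exists_roots_of_alternating (reduced .second (2 * n) lam 0)
    (fun i => (i : ℝ) - 1 / 2 - n) (n + 1) _ (fun i _ => by push_cast; linarith) hsign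
  have h0 := ne_zero_of_sign (hsign 0 (Nat.zero_le _))
  have hlt := lt_of_between (N := n + 1) (t := fun i : ℕ => (i : ℝ) - 1 / 2 - n) (b := b)
    (fun i j hij _ => by simpa using hij) (fun i hi => ⟨(hb i hi).1, (hb i hi).2.1⟩)
  have hdeg := natDegree_reduced_zero_le (n := n) (lam := lam) (c := .second)
  have hfix : ∀ m, (reduced .second (2 * n) lam m).IsRoot 0 := fun m =>
    isRoot_weighted_zero (.inr rfl) _
  have hlast : b n = 0 := by
    obtain ⟨j, hj, h⟩ := (isRoot_iff_exists h0 hdeg hlt (fun i hi => (hb i hi).2.2) 0).1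
      (hfix 0)
    have h2 := (hb j hj).2.1
    rw [← h] at h2
    push_cast at h2
    have h3 : (n : ℝ) < (j + 1 : ℕ) := by
      push_cast
      linarith
    have h4 : n < j + 1 := by exact_mod_cast h3
    rw [h]
    congr 1
    omega
  obtain ⟨δ, hδ, β, h1, h2, -, h4, h5, -⟩ := isPolyFamily_reduced.exists_branches h0 hdeg hlt
    (fun i hi => (hb i hi).2.2) (fun i hi => (hb i hi).1) (fun i hi => (hb i hi).2.1)
  refine ⟨δ, hδ, β, simpleRootBranches_even h1, otherRootsEscape_even h2, ?_, ?_⟩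
  · intro m hm i hi
    have := h4 m hm i hi
    push_cast at this
    exact ⟨this.1, by linarith⟩
  · intro m hm
    rw [← hlast]
    exact h5 n (by omega) (fun m => hlast ▸ hfix m) m hm

/-- Here s decreases in α, so the points i + 1/2 correspond to k = i; the first lies to the left of
e_0, the others are e_{i-1}. -/
theorem exists_branches_third_even (hlam : lam ≠ 0) :
    ∃ δ > 0, ∃ β : ℕ → ℝ → ℝ,
      SimpleRootBranches (pMinusOne .third (2 * n) lam) (nbhd δ) (puncturedNbhd δ) n β ∧
      NoOtherRoots (pMinusOne .third (2 * n) lam) (puncturedNbhd δ) n β ∧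
      (∀ m ∈ nbhd δ, ∀ i < n, (i : ℝ) + 1 / 2 < β i m ∧ β i m < (i : ℝ) + 3 / 2) := by
  have hn0 : (0 : ℝ) ≤ n := n.cast_nonneg
  have hsign : ∀ i ≤ n, 0 < normFactor .third n lam * (-1) ^ i *
      (reduced .third (2 * n) lam 0).eval ((i : ℝ) + 1 / 2) := by
    intro i hi
    have h := sign_reduced (c := .third) hlam (x := (i : ℝ) + 1 / 2) hi
      (by rw [shift]; ring) (by rw [absB]; linarith)
      (fun l hl => by
        have : (0 : ℝ) ≤ i := Nat.cast_nonneg _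
        rw [absB]
        linarith)
    linarith
  obtain ⟨b, hb⟩ := exists_roots_of_alternating (reduced .third (2 * n) lam 0)
    (fun i => (i : ℝ) + 1 / 2) n _ (fun i _ => by push_cast; linarith) hsign
  have h0 := ne_zero_of_sign (hsign 0 n.zero_le)
  have hlt := lt_of_between (N := n) (t := fun i : ℕ => (i : ℝ) + 1 / 2) (b := b)
    (fun i j hij _ => by simpa using hij) (fun i hi => ⟨(hb i hi).1, (hb i hi).2.1⟩)
  have hdeg := natDegree_reduced_le (n := n) (lam := lam) (c := .third) (.inr rfl)
  obtain ⟨δ, hδ, β, h1, -, -, h4, -, h6⟩ := isPolyFamily_reduced.exists_branches h0 (hdeg 0) hlt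
    (fun i hi => (hb i hi).2.2) (fun i hi => (hb i hi).1) (fun i hi => (hb i hi).2.1)
  refine ⟨δ, hδ, β, simpleRootBranches_even h1, noOtherRoots_even (h6 hdeg), ?_⟩
  intro m hm i hi
  have := h4 m hm i hi
  push_cast at this
  exact ⟨this.1, by linarith⟩

/-- The displaced test point exists only for n > 0; for n = 0 the polynomial is evaluated directly.
-/
theorem reduced_fourth_zero_ne_zero (hlam : lam ≠ 0) : reduced .fourth (2 * n) lam 0 ≠ 0 := by
  rcases Nat.eq_zero_or_pos n with rfl | hn
  · have h : normV .fourth (2 * 0) lam 0 1 = 2 := by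
      rw [normV_succ hlam, normV_zero, normU_zero, absB, shift]
      norm_num
    rintro h0
    rw [normV_eq (n := 0), h0] at h
    norm_num at h
  · refine ne_zero_of_sign (a := (-1) ^ n * normFactor .fourth n lam) (x := (n : ℝ) + 1 / 4) ?_
    rw [mul_assoc]
    exact sign_reduced_fourth hlam hn.ne' (by rw [shift]; ring)

/-- Sign changes give n roots below n + 1/4, and the shared root n + 1/2 is the remaining one. -/
theorem exists_branches_fourth_even (hlam : lam ≠ 0) :
    ∃ δ > 0, ∃ β : ℕ → ℝ → ℝ,
      SimpleRootBranches (pMinusOne .fourth (2 * n) lam) (nbhd δ) (puncturedNbhd δ) (n + 1) β ∧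
      OtherRootsEscape (pMinusOne .fourth (2 * n) lam) (puncturedNbhd δ) (n + 1) β ∧
      (∀ m ∈ nbhd δ, ∀ i < n, (i : ℝ) + 1 / 2 < β i m ∧ β i m < (i : ℝ) + 3 / 2) ∧
      (∀ m ∈ nbhd δ, β n m = (n : ℝ) + 1 / 2) := by
  -- The last half-integer n + 1/2 is the shared root, so the last test point is moved down to n +
  -- 1/4.
  set t : ℕ → ℝ := fun i => if i < n then (i : ℝ) + 1 / 2 else (i : ℝ) + 1 / 4 with ht
  have htlt : ∀ i < n, t i = (i : ℝ) + 1 / 2 := fun i hi => if_pos hi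
  have htn : t n = (n : ℝ) + 1 / 4 := if_neg (lt_irrefl n)
  have htle : ∀ i, t i ≤ (i : ℝ) + 1 / 2 := by
    intro i
    simp only [ht]
    split <;> linarith
  have htge : ∀ i : ℕ, (i : ℝ) + 1 / 4 ≤ t i := by
    intro i
    simp only [ht]
    split <;> linarith
  have hstep : ∀ i, t i < t (i + 1) := by
    intro i
    have h1 := htle i
    have h2 := htge (i + 1)
    push_cast at h2
    linarith
  have hsign : n ≠ 0 → ∀ i ≤ n, 0 < normFactor .fourth n lam * (-1) ^ i *
      (reduced .fourth (2 * n) lam 0).eval (t i) := by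
    intro hn i hi
    rcases hi.lt_or_eq with hi | rfl
    · have hi' : (i : ℝ) + 1 ≤ n := by exact_mod_cast hi
      have h := sign_reduced (c := .fourth) hlam (x := t i) hi.le
        (by rw [htlt i hi, shift]; ring) (by rw [absB]; linarith)
        (fun l hl => by
          rw [absB]
          linarith)
      linarith
    · have h := sign_reduced_fourth hlam hn (x := t i) (by rw [htn, shift]; ring)
      linarith
  obtain ⟨b, hb⟩ : ∃ b : ℕ → ℝ, ∀ i < n, t i < b i ∧ b i < t (i + 1) ∧
      (reduced .fourth (2 * n) lam 0).IsRoot (b i) := by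
    rcases Nat.eq_zero_or_pos n with hn | hn
    · exact ⟨0, fun i hi => by omega⟩
    · exact exists_roots_of_alternating _ t n _ (fun i _ => hstep i) (hsign hn.ne')
  have hfix : ∀ m, (reduced .fourth (2 * n) lam m).IsRoot ((n : ℝ) + 1 / 2) := by
    intro m
    have h := isRoot_weighted_fourth (d := 2 * n) (lam := lam) (evenWeight m) (2 * n)
    rwa [show (((2 * n : ℕ) : ℝ) + 1) / 2 = (n : ℝ) + 1 / 2 by push_cast; ring] at h
  set b' : ℕ → ℝ := fun i => if i < n then b i else (n : ℝ) + 1 / 2 with hb'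
  have hb'lt : ∀ i < n, b' i = b i := fun i hi => if_pos hi
  have hb'n : b' n = (n : ℝ) + 1 / 2 := if_neg (lt_irrefl n)
  have hltb := lt_of_between (N := n) (t := t) (b := b)
    (fun i j hij _ => (strictMono_nat_of_lt_succ hstep).monotone hij)
    (fun i hi => ⟨(hb i hi).1, (hb i hi).2.1⟩)
  have hup : ∀ i < n, b i < (i : ℝ) + 3 / 2 := by
    intro i hi
    have h1 := (hb i hi).2.1
    have h2 := htle (i + 1)
    push_cast at h2
    linarith
  have hlt : ∀ i j, i < j → j < n + 1 → b' i < b' j := by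
    intro i j hij hj
    rcases (Nat.lt_succ_iff.1 hj).lt_or_eq with hj | rfl
    · rw [hb'lt i (hij.trans hj), hb'lt j hj]
      exact hltb i j hij hj
    · rw [hb'lt i hij, hb'n]
      have h1 := hup i hij
      have h2 : (i : ℝ) + 1 ≤ j := by exact_mod_cast hij
      linarith
  have hroot : ∀ i < n + 1, (reduced .fourth (2 * n) lam 0).IsRoot (b' i) := by
    intro i hi
    rcases (Nat.lt_succ_iff.1 hi).lt_or_eq with hi | rfl
    · rw [hb'lt i hi]
      exact (hb i hi).2.2
    · rw [hb'n]
      exact hfix 0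
  have hlo : ∀ i < n + 1, t i < b' i := by
    intro i hi
    rcases (Nat.lt_succ_iff.1 hi).lt_or_eq with hi | rfl
    · rw [hb'lt i hi]
      exact (hb i hi).1
    · rw [hb'n, htn]
      linarith
  have hhi : ∀ i < n + 1, b' i < (i : ℝ) + 3 / 2 := by
    intro i hi
    rcases (Nat.lt_succ_iff.1 hi).lt_or_eq with hi | rfl
    · rw [hb'lt i hi]
      exact hup i hi
    · rw [hb'n]
      linarith
  obtain ⟨δ, hδ, β, h1, h2, -, h4, h5, -⟩ := isPolyFamily_reduced.exists_branches
    (reduced_fourth_zero_ne_zero hlam) natDegree_reduced_zero_le hlt hroot hlo hhi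
  refine ⟨δ, hδ, β, simpleRootBranches_even h1, otherRootsEscape_even h2, ?_, ?_⟩
  · intro m hm i hi
    have := h4 m hm i (by omega)
    rwa [htlt i hi] at this
  · intro m hm
    rw [← hb'n]
    exact h5 n n.lt_succ_self (fun m => by rw [hb'n]; exact hfix m) m hm

end Cases

end DiracHeun

/-! ### Assembly of the eight cases -/

open DiracHeun in
theorem theorem2 (d : ℕ) (lam : ℝ) (hlam : lam ≠ 0) :
    -- first subcase, odd degree
    (Odd d →
      pMinusOne .first d lam 0 = oddProduct .first d lam ∧
      ∃ δ > 0, ∃ β : ℕ → ℝ → ℝ,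
        SimpleRootBranches (pMinusOne .first d lam) (nbhd δ) (nbhd δ) ((d + 1) / 2) β ∧
        NoOtherRoots (pMinusOne .first d lam) (nbhd δ) ((d + 1) / 2) β ∧
        (∀ i < (d + 1) / 2, β i 0 = (i : ℝ) - ((d : ℝ) - 1) / 2) ∧
        (∀ m ∈ nbhd δ, β ((d + 1) / 2 - 1) m = 0)) ∧
    -- first subcase, even degree
    (Even d → d ≠ 0 →
      p .first d lam 0 0 = evenProduct .first d lam ∧
      ∃ e : ℕ → ℝ, (∀ i < d / 2, e i = (i : ℝ) + 1 / 2 - (d : ℝ) / 2) ∧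
        IsSimpleRootList (evenProduct .first d lam) (d / 2) e ∧
      ∃ δ > 0, ∃ β : ℕ → ℝ → ℝ,
        SimpleRootBranches (pMinusOne .first d lam) (nbhd δ) (puncturedNbhd δ) (d / 2) β ∧
        NoOtherRoots (pMinusOne .first d lam) (puncturedNbhd δ) (d / 2) β ∧
        (∀ m ∈ nbhd δ, ∀ i < d / 2, e i < β i m ∧ (i + 1 < d / 2 → β i m < e (i + 1))) ∧
        (∀ m ∈ nbhd δ, β (d / 2 - 1) m = 0)) ∧
    -- second subcase, odd degree
    (Odd d →
      pMinusOne .second d lam 0 = oddProduct .second d lam ∧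
      ∃ δ > 0, ∃ β : ℕ → ℝ → ℝ,
        SimpleRootBranches (pMinusOne .second d lam) (nbhd δ) (nbhd δ) ((d + 1) / 2) β ∧
        OtherRootsEscape (pMinusOne .second d lam) (nbhd δ) ((d + 1) / 2) β ∧
        (∀ i < (d + 1) / 2, β i 0 = (i : ℝ) - ((d : ℝ) - 1) / 2) ∧
        (∀ m ∈ nbhd δ, β ((d + 1) / 2 - 1) m = 0)) ∧
    -- second subcase, even degree: `d / 2` roots and, in addition, the root `0`
    (Even d →
      p .second d lam 0 0 = evenProduct .second d lam ∧
      ∃ e : ℕ → ℝ, (∀ i < d / 2, e i = (i : ℝ) + 1 / 2 - (d : ℝ) / 2) ∧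
        IsSimpleRootList (evenProduct .second d lam) (d / 2) e ∧
      ∃ δ > 0, ∃ β : ℕ → ℝ → ℝ,
        SimpleRootBranches (pMinusOne .second d lam) (nbhd δ) (puncturedNbhd δ) (d / 2 + 1) β ∧
        OtherRootsEscape (pMinusOne .second d lam) (puncturedNbhd δ) (d / 2 + 1) β ∧
        (∀ m ∈ nbhd δ, ∀ i < d / 2, β i m < e i ∧ e i < β (i + 1) m) ∧
        (∀ m ∈ nbhd δ, β (d / 2) m = 0)) ∧
    -- third subcase, odd degree
    (Odd d →
      pMinusOne .third d lam 0 = oddProduct .third d lam ∧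
      ∃ δ > 0, ∃ β : ℕ → ℝ → ℝ,
        SimpleRootBranches (pMinusOne .third d lam) (nbhd δ) (nbhd δ) ((d + 1) / 2) β ∧
        NoOtherRoots (pMinusOne .third d lam) (nbhd δ) ((d + 1) / 2) β ∧
        (∀ i < (d + 1) / 2, β i 0 = (i : ℝ) + 1)) ∧
    -- third subcase, even degree
    (Even d →
      p .third d lam 0 0 = evenProduct .third d lam ∧
      ∃ e : ℕ → ℝ, (∀ i < d / 2, e i = (i : ℝ) + 3 / 2) ∧
        IsSimpleRootList (evenProduct .third d lam) (d / 2) e ∧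
      ∃ δ > 0, ∃ β : ℕ → ℝ → ℝ,
        SimpleRootBranches (pMinusOne .third d lam) (nbhd δ) (puncturedNbhd δ) (d / 2) β ∧
        NoOtherRoots (pMinusOne .third d lam) (puncturedNbhd δ) (d / 2) β ∧
        (∀ m ∈ nbhd δ, ∀ i < d / 2, β i m < e i ∧ (i + 1 < d / 2 → e i < β (i + 1) m))) ∧
    -- fourth subcase, odd degree
    (Odd d →
      pMinusOne .fourth d lam 0 = oddProduct .fourth d lam ∧
      ∃ δ > 0, ∃ β : ℕ → ℝ → ℝ,
        SimpleRootBranches (pMinusOne .fourth d lam) (nbhd δ) (nbhd δ) ((d + 1) / 2) β ∧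
        OtherRootsEscape (pMinusOne .fourth d lam) (nbhd δ) ((d + 1) / 2) β ∧
        (∀ i < (d + 1) / 2, β i 0 = (i : ℝ) + 1) ∧
        (∀ m ∈ nbhd δ, β ((d + 1) / 2 - 1) m = ((d : ℝ) + 1) / 2)) ∧
    -- fourth subcase, even degree: `d / 2` roots and, in addition, the shared root `(d + 1) / 2`
    (Even d →
      p .fourth d lam 0 0 = evenProduct .fourth d lam ∧
      ∃ e : ℕ → ℝ, (∀ i < d / 2, e i = (i : ℝ) + 3 / 2) ∧
        IsSimpleRootList (evenProduct .fourth d lam) (d / 2) e ∧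
      ∃ δ > 0, ∃ β : ℕ → ℝ → ℝ,
        SimpleRootBranches (pMinusOne .fourth d lam) (nbhd δ) (puncturedNbhd δ) (d / 2 + 1) β ∧
        OtherRootsEscape (pMinusOne .fourth d lam) (puncturedNbhd δ) (d / 2 + 1) β ∧
        (∀ m ∈ nbhd δ, ∀ i < d / 2, β i m < e i ∧ (i + 1 < d / 2 → e i < β (i + 1) m)) ∧
        (∀ m ∈ nbhd δ, β (d / 2) m = ((d : ℝ) + 1) / 2)) := by
  refine ⟨?_, ?_, ?_, ?_, ?_, ?_, ?_, ?_⟩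
  · rintro ⟨n, rfl⟩
    refine ⟨pMinusOne_zero_eq_oddProduct n, ?_⟩
    rw [show (2 * n + 1 + 1) / 2 = n + 1 by omega]
    obtain ⟨δ, hδ, β, h1, -, h3, h4, h5⟩ :=
      exists_branches_odd_left (n := n) (c := .first) (.inl rfl) hlam
    exact ⟨δ, hδ, β, h1, h5 (.inl rfl), h3, h4⟩
  · intro hd hd0
    obtain ⟨n, rfl⟩ := even_iff_exists_two_mul.1 hd
    rw [show 2 * n / 2 = n by omega]
    refine ⟨p_zero_eq_evenProduct n, _, fun i _ => rfl,
      isSimpleRootList_evenProduct_left (.inl rfl) hlam, ?_⟩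
    obtain ⟨δ, hδ, β, h1, h2, h3, h4⟩ :=
      exists_branches_first_even (n := n) hlam (by omega)
    refine ⟨δ, hδ, β, h1, h2, fun m hm i hi => ?_, h4⟩
    have h := h3 m hm i hi
    push_cast
    exact ⟨by linarith, fun _ => by linarith⟩
  · rintro ⟨n, rfl⟩
    refine ⟨pMinusOne_zero_eq_oddProduct n, ?_⟩
    rw [show (2 * n + 1 + 1) / 2 = n + 1 by omega]
    obtain ⟨δ, hδ, β, h1, h2, h3, h4, -⟩ :=
      exists_branches_odd_left (n := n) (c := .second) (.inr rfl) hlam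
    exact ⟨δ, hδ, β, h1, h2, h3, h4⟩
  · intro hd
    obtain ⟨n, rfl⟩ := even_iff_exists_two_mul.1 hd
    rw [show 2 * n / 2 = n by omega]
    refine ⟨p_zero_eq_evenProduct n, _, fun i _ => rfl,
      isSimpleRootList_evenProduct_left (.inr rfl) hlam, ?_⟩
    obtain ⟨δ, hδ, β, h1, h2, h3, h4⟩ := exists_branches_second_even (n := n) hlam
    refine ⟨δ, hδ, β, h1, h2, fun m hm i hi => ?_, h4⟩
    have h := h3 m hm i (by omega)
    -- The lower bound for branch i + 1 is exactly e_i.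
    have h' := h3 m hm (i + 1) (by omega)
    push_cast at h' ⊢
    exact ⟨by linarith, by linarith⟩
  · rintro ⟨n, rfl⟩
    refine ⟨pMinusOne_zero_eq_oddProduct n, ?_⟩
    rw [show (2 * n + 1 + 1) / 2 = n + 1 by omega]
    obtain ⟨δ, hδ, β, h1, -, h3, -, h5⟩ :=
      exists_branches_odd_right (n := n) (c := .third) (.inl rfl) hlam
    exact ⟨δ, hδ, β, h1, h5 (.inr rfl), h3⟩
  · intro hd
    obtain ⟨n, rfl⟩ := even_iff_exists_two_mul.1 hd
    rw [show 2 * n / 2 = n by omega]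
    refine ⟨p_zero_eq_evenProduct n, _, fun i _ => rfl,
      isSimpleRootList_evenProduct_right (.inl rfl) hlam, ?_⟩
    obtain ⟨δ, hδ, β, h1, h2, h3⟩ := exists_branches_third_even (n := n) hlam
    refine ⟨δ, hδ, β, h1, h2, fun m hm i hi => ⟨(h3 m hm i hi).2, fun hi' => ?_⟩⟩
    have h := (h3 m hm (i + 1) hi').1
    push_cast at h
    linarith
  · rintro ⟨n, rfl⟩
    refine ⟨pMinusOne_zero_eq_oddProduct n, ?_⟩
    rw [show (2 * n + 1 + 1) / 2 = n + 1 by omega]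
    obtain ⟨δ, hδ, β, h1, h2, h3, h4, -⟩ :=
      exists_branches_odd_right (n := n) (c := .fourth) (.inr rfl) hlam
    exact ⟨δ, hδ, β, h1, h2, h3, h4 rfl⟩
  · intro hd
    obtain ⟨n, rfl⟩ := even_iff_exists_two_mul.1 hd
    rw [show 2 * n / 2 = n by omega]
    refine ⟨p_zero_eq_evenProduct n, _, fun i _ => rfl,
      isSimpleRootList_evenProduct_right (.inr rfl) hlam, ?_⟩
    obtain ⟨δ, hδ, β, h1, h2, h3, h4⟩ := exists_branches_fourth_even (n := n) hlam
    refine ⟨δ, hδ, β, h1, h2,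
      fun m hm i hi => ⟨(h3 m hm i hi).2, fun hi' => ?_⟩, fun m hm => ?_⟩
    · have h := (h3 m hm (i + 1) hi').1
      push_cast at h
      linarith
    · rw [h4 m hm]
      push_cast
      ring
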